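/- \textbf{Conventions.} A \emph{groupoid} is an \'etale topological groupoid $G$ with object space $G^0$: range and source maps $r,s\colon G\rightrightarrows G^0$ are local homeomorphisms, and multiplication, units and inversion are continuous. A \emph{groupoid correspondence} $X\colon H\leftarrow G$ is a space $X$ with commuting continuous actions of $H$ on the left (anchor map $r\colon X\to H^0$) and of $G$ on the right (anchor map $s\colon X\to G^0$), such that $s$ is a local homeomorphism and the right action is basic, that is, $X\times_{s,G^0,r}G\to X\times X$, $(x,g)\mapsto(x\cdot g,x)$, is a homeomorphism onto its image. It is \emph{proper} if the induced map $r_*\colon X/G\to H^0$ is proper. A groupoid is \emph{locally compact} if $G^0$ is Hausdorff and locally compact; a correspondence between locally compact groupoids is \emph{locally compact} if $X/G$ is Hausdorff. Correspondences $X\colon K\leftarrow H$, $Y\colon H\leftarrow G$ are composed by $X\circ_H Y=(X\times_{s,H^0,r}Y)/H$. For a category $\mathcal C$, a \emph{$\mathcal C$-shaped diagram} $F$ of groupoid correspondences consists of groupoids $G_x$ for objects $x$, correspondences $X_g\colon G_{x'}\leftarrow G_x$ for arrows $g\colon x\to x'$, and isomorphisms of correspondences (biequivariant homeomorphisms) $\mu_{g,h}\colon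 X_g\circ X_h\to X_{gh}$ for composable $g,h$, written $[\gamma_1,\gamma_2]\mapsto\gamma_1\cdot\gamma_2$, such that $X_{\mathrm{id}_x}$ is (identified, by an isomorphism of correspondences, with) the identity correspondence $G_x$, $\mu_{g,\mathrm{id}}$ and $\mu_{\mathrm{id},g}$ are the canonical isomorphisms, and $(\gamma_1\gamma_2)\gamma_3=\gamma_1(\gamma_2\gamma_3)$. It is proper, respectively locally compact, if all $X_g$ (respectively all $G_x$ and all $X_g$) are so. Put $G^0:=\bigsqcup_x G_x^0$. An \emph{$F$-action} on a topological space $Y$ consists of a partition $Y=\bigsqcup_x Y_x$ into clopen subsets, continuous maps $r\colon Y_x\to G_x^0$ (equivalently, one continuous map $r\colon Y\to G^0$), and open, continuous, surjective maps $X_g\times_{s,G_x^0,r}Y_x\to Y_{x'}$, $(\gamma,y)\mapsto\gamma\cdot y$, for all arrows $g\colon x\to x'$, such that (1) $r(\gamma\cdot y)=r(\gamma)$, and $\gamma_1\cdot(\gamma_2\cdot y)=(\gamma_1\cdot\gamma_2)\cdot y$ for composable arrows; (2) if $\gamma\cdot y=\gamma'\cdot y'$ with $\gamma,\gamma'\in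 X_g$ and $y,y'\in Y_x$, there is $\eta\in G_x$ with $\gamma'=\gamma\cdot\eta$ and $y=\eta\cdot y'$. A continuous map $\varphi\colon Y\to Y'$ between spaces with $F$-actions is \emph{$F$-equivariant} if $\varphi(Y_x)\subseteq Y'_x$ for all $x$, $r\circ\varphi=r$, and $\varphi(\gamma\cdot y)=\gamma\cdot\varphi(y)$ whenever $\gamma\cdot y$ is defined. For a locally compact Hausdorff space $B$ and a topological space $Y$ with a continuous map $r\colon Y\to B$, the \emph{relative Stone--\v{C}ech compactification} $\beta_B Y$ is the spectrum of the commutative $C^*$-algebra $C_b(Y)\cdot r^*(C_0(B))\subseteq C_b(Y)$, and $i_Y\colon Y\to\beta_B Y$ maps a point to the evaluation at it. \textbf{Theorem.} Let $F$ be a $\mathcal C$-shaped diagram of proper, locally compact groupoid correspondences. Let $Y$ be a topological space with an $F$-action. Then there is a unique $F$-action on $\beta_{G^0}Y$ such that the canonical map $i_Y\colon Y\to\beta_{G^0}Y$ is $F$-equivariant. -/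

import Mathlib

open CategoryTheory Topology
open scoped ZeroAtInfty BoundedContinuousFunction

universe u v w t t'

/-- An étale topological groupoid: topological spaces of objects and arrows with range and source
maps that are local homeomorphisms (hence continuous), and continuous multiplication, unit and
inversion.  The product `g · h` is defined when `s g = r h`. -/
structure EtaleGroupoid where
  Obj : Type u
  Arr : Type u
  [topObj : TopologicalSpace Obj]
  [topArr : TopologicalSpace Arr]
  r : Arr → Obj
  s : Arr → Obj
  unit : Obj → Arr
  mul : (g h : Arr) → s g = r h → Arr
  inv : Arr → Arr
  r_unit : ∀ x, r (unit x) = x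
  s_unit : ∀ x, s (unit x) = x
  r_mul : ∀ g h (e : s g = r h), r (mul g h e) = r g
  s_mul : ∀ g h (e : s g = r h), s (mul g h e) = s h
  r_inv : ∀ g, r (inv g) = s g
  s_inv : ∀ g, s (inv g) = r g
  mul_assoc : ∀ g h k (e : s g = r h) (e' : s h = r k),
    mul (mul g h e) k ((s_mul g h e).trans e') =
      mul g (mul h k e') (e.trans (r_mul h k e').symm)
  unit_mul : ∀ g, mul (unit (r g)) g (s_unit (r g)) = g
  mul_unit : ∀ g, mul g (unit (s g)) (r_unit (s g)).symm = g
  mul_inv : ∀ g, mul g (inv g) (r_inv g).symm = unit (r g)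
  inv_mul : ∀ g, mul (inv g) g (s_inv g) = unit (s g)
  continuous_mul :
    Continuous fun p : {p : Arr × Arr // s p.1 = r p.2} => mul p.1.1 p.1.2 p.2
  continuous_unit : Continuous unit
  continuous_inv : Continuous inv
  isLocalHomeomorph_r : IsLocalHomeomorph r
  isLocalHomeomorph_s : IsLocalHomeomorph s

attribute [instance] EtaleGroupoid.topObj EtaleGroupoid.topArr

/-- A groupoid is locally compact if its object space is Hausdorff and locally compact. -/
structure EtaleGroupoid.IsLocallyCompact (G : EtaleGroupoid.{u}) : Prop where
  t2 : T2Space G.Obj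
  locallyCompact : LocallyCompactSpace G.Obj

/-- An étale groupoid correspondence `H ← G`: a space with commuting continuous actions of `H` on
the left and `G` on the right, such that the right anchor map `s` is a local homeomorphism and the
right action is basic, that is, `(x, g) ↦ (x · g, x)` is a homeomorphism onto its image. -/
structure Correspondence (H G : EtaleGroupoid.{u}) where
  carrier : Type u
  [top : TopologicalSpace carrier]
  r : carrier → H.Obj
  s : carrier → G.Obj
  lact : (h : H.Arr) → (x : carrier) → H.s h = r x → carrier
  ract : (x : carrier) → (g : G.Arr) → s x = G.r g → carrier
  r_lact : ∀ h x (e : H.s h = r x), r (lact h x e) = H.r h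
  s_lact : ∀ h x (e : H.s h = r x), s (lact h x e) = s x
  r_ract : ∀ x g (e : s x = G.r g), r (ract x g e) = r x
  s_ract : ∀ x g (e : s x = G.r g), s (ract x g e) = G.s g
  unit_lact : ∀ x, lact (H.unit (r x)) x (H.s_unit (r x)) = x
  ract_unit : ∀ x, ract x (G.unit (s x)) (G.r_unit (s x)).symm = x
  mul_lact : ∀ h k x (e : H.s h = H.r k) (e' : H.s k = r x),
    lact (H.mul h k e) x ((H.s_mul h k e).trans e') =
      lact h (lact k x e') (e.trans (r_lact k x e').symm)
  ract_mul : ∀ x g k (e : s x = G.r g) (e' : G.s g = G.r k),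
    ract x (G.mul g k e') (e.trans (G.r_mul g k e').symm) =
      ract (ract x g e) k ((s_ract x g e).trans e')
  lact_ract : ∀ h x g (e : H.s h = r x) (e' : s x = G.r g),
    ract (lact h x e) g ((s_lact h x e).trans e') =
      lact h (ract x g e') (e.trans (r_ract x g e').symm)
  continuous_r : Continuous r
  continuous_lact :
    Continuous fun p : {p : H.Arr × carrier // H.s p.1 = r p.2} => lact p.1.1 p.1.2 p.2
  continuous_ract :
    Continuous fun p : {p : carrier × G.Arr // s p.1 = G.r p.2} => ract p.1.1 p.1.2 p.2
  isLocalHomeomorph_s : IsLocalHomeomorph s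
  basic : IsEmbedding fun p : {p : carrier × G.Arr // s p.1 = G.r p.2} =>
    ((ract p.1.1 p.1.2 p.2, p.1.1) : carrier × carrier)

attribute [instance] Correspondence.top

namespace Correspondence

variable {K H G : EtaleGroupoid.{u}}

/-- Two points are equivalent if they lie in the same orbit of the right action. -/
def orbitSetoid (X : Correspondence H G) : Setoid X.carrier where
  r x y := ∃ (g : G.Arr) (e : X.s x = G.r g), X.ract x g e = y
  iseqv := by
    refine ⟨fun x => ⟨_, _, X.ract_unit x⟩, ?_, ?_⟩
    · rintro x y ⟨g, e, rfl⟩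
      refine ⟨G.inv g, (X.s_ract x g e).trans (G.r_inv g).symm, ?_⟩
      rw [← X.ract_mul x g (G.inv g) e (G.r_inv g).symm]
      have : ∀ (k : G.Arr) (e' : X.s x = G.r k), k = G.unit (X.s x) → X.ract x k e' = x := by
        rintro k e' rfl
        exact X.ract_unit x
      exact this _ _ (by rw [G.mul_inv, e])
    · rintro x y z ⟨g, e, rfl⟩ ⟨k, e', rfl⟩
      exact ⟨_, _, X.ract_mul x g k e ((X.s_ract x g e).symm.trans e')⟩

/-- The orbit space `X/G`, with the quotient topology. -/
abbrev OrbitSpace (X : Correspondence H G) : Type u := Quotient X.orbitSetoid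

/-- The map `X/G → H⁰` induced by the left anchor map. -/
def orbitMap (X : Correspondence H G) : X.OrbitSpace → H.Obj :=
  Quotient.lift X.r (by rintro x y ⟨g, e, rfl⟩; exact (X.r_ract x g e).symm)

/-- A correspondence is proper if the induced map `X/G → H⁰` is proper. -/
def IsProper (X : Correspondence H G) : Prop := IsProperMap X.orbitMap

/-- A correspondence between locally compact groupoids is locally compact if its orbit space is
Hausdorff. -/
structure IsLocallyCompact (X : Correspondence H G) : Prop where
  left : H.IsLocallyCompact
  right : G.IsLocallyCompact
  t2 : T2Space X.OrbitSpace

/-- The fibre product `X ×_{s, H⁰, r} Y`. -/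
abbrev FibreProd (X : Correspondence K H) (Y : Correspondence H G) : Type u :=
  {p : X.carrier × Y.carrier // X.s p.1 = Y.r p.2}

/-- The relation `(x · h, y) ∼ (x, h · y)` on the fibre product; its classes are the orbits of
the diagonal action `(x, y) · h = (x · h, h⁻¹ · y)`. -/
def compSetoid (X : Correspondence K H) (Y : Correspondence H G) : Setoid (FibreProd X Y) where
  r p q := ∃ (h : H.Arr) (e : X.s p.1.1 = H.r h) (e' : H.s h = Y.r q.1.2),
    X.ract p.1.1 h e = q.1.1 ∧ p.1.2 = Y.lact h q.1.2 e'
  iseqv := by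
    have hl : ∀ (y : Y.carrier) (k : H.Arr) (e' : H.s k = Y.r y), k = H.unit (Y.r y) →
        Y.lact k y e' = y := by
      rintro y k e' rfl
      exact Y.unit_lact y
    have hr : ∀ (x : X.carrier) (k : H.Arr) (e' : X.s x = H.r k), k = H.unit (X.s x) →
        X.ract x k e' = x := by
      rintro x k e' rfl
      exact X.ract_unit x
    refine ⟨fun p => ⟨H.unit (X.s p.1.1), (H.r_unit _).symm, (H.s_unit _).trans p.2,
      X.ract_unit _, (hl _ _ _ (by rw [p.2])).symm⟩, ?_, ?_⟩
    · rintro ⟨⟨x, y⟩, hp⟩ ⟨⟨x', y'⟩, hq⟩ ⟨h, e, e', h1, h2⟩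
      dsimp only at e e' h1 h2 hp hq
      subst h1
      subst h2
      refine ⟨H.inv h, (X.s_ract x h e).trans (H.r_inv h).symm,
        (H.s_inv h).trans (Y.r_lact h y' e').symm, ?_, ?_⟩
      · exact (X.ract_mul x h (H.inv h) e (H.r_inv h).symm).symm.trans
          (hr _ _ _ (by rw [H.mul_inv, e]))
      · exact ((Y.mul_lact (H.inv h) h y' (H.s_inv h) e').symm.trans
          (hl _ _ _ (by rw [H.inv_mul, e']))).symm
    · rintro ⟨⟨x, y⟩, hp⟩ ⟨⟨x', y'⟩, hq⟩ ⟨⟨x'', y''⟩, hz⟩ ⟨h, e, e', h1, h2⟩ ⟨k, f, f', k1, k2⟩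
      dsimp only at e e' h1 h2 f f' k1 k2 hp hq hz
      subst h1
      subst h2
      subst k1
      subst k2
      have hk : H.s h = H.r k := e'.trans (Y.r_lact k y'' f')
      exact ⟨H.mul h k hk, e.trans (H.r_mul h k hk).symm, (H.s_mul h k hk).trans f',
        X.ract_mul x h k e hk, (Y.mul_lact h k y'' hk f').symm⟩

/-- The space underlying the composite correspondence `X ∘_H Y`, the orbit space of the fibre
product with the quotient topology. -/
abbrev Comp (X : Correspondence K H) (Y : Correspondence H G) : Type u :=
  Quotient (compSetoid X Y)

/-- The class `[x, y]` in the composite.  The composite has the anchor maps `r [x, y] = r x`,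
`s [x, y] = s y` and the actions `k · [x, y] = [k · x, y]`, `[x, y] · g = [x, y · g]`. -/
def Comp.mk (X : Correspondence K H) (Y : Correspondence H G) (x : X.carrier) (y : Y.carrier)
    (e : X.s x = Y.r y) : Comp X Y :=
  Quotient.mk (compSetoid X Y) ⟨(x, y), e⟩

end Correspondence

/-- A `C`-shaped diagram of étale groupoid correspondences.  An arrow `g : x ⟶ y` gives a
correspondence `corr g : gpd y ← gpd x`, and the composite of `g : y ⟶ z` after `h : x ⟶ y` is
`h ≫ g`.  The maps `mu g h` are isomorphisms of correspondences
`corr g ∘ corr h ≅ corr (h ≫ g)`.  The correspondence of an identity arrow is identified with the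
identity correspondence (the arrow space with the two multiplication actions) through `unitor`;
it may be taken to be an identity map. -/
structure Diagram (C : Type v) [Category.{w} C] where
  gpd : C → EtaleGroupoid.{u}
  corr : {x y : C} → (x ⟶ y) → Correspondence (gpd y) (gpd x)
  mu : {x y z : C} → (g : y ⟶ z) → (h : x ⟶ y) →
    Correspondence.Comp (corr g) (corr h) ≃ₜ (corr (h ≫ g)).carrier
  r_mu : ∀ {x y z : C} (g : y ⟶ z) (h : x ⟶ y) (a b) (e : (corr g).s a = (corr h).r b),
    (corr (h ≫ g)).r (mu g h (.mk _ _ a b e)) = (corr g).r a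
  s_mu : ∀ {x y z : C} (g : y ⟶ z) (h : x ⟶ y) (a b) (e : (corr g).s a = (corr h).r b),
    (corr (h ≫ g)).s (mu g h (.mk _ _ a b e)) = (corr h).s b
  mu_lact : ∀ {x y z : C} (g : y ⟶ z) (h : x ⟶ y) (a b) (e : (corr g).s a = (corr h).r b)
    (k : (gpd z).Arr) (ek : (gpd z).s k = (corr g).r a),
    mu g h (.mk _ _ ((corr g).lact k a ek) b (((corr g).s_lact k a ek).trans e)) =
      (corr (h ≫ g)).lact k (mu g h (.mk _ _ a b e)) (ek.trans (r_mu g h a b e).symm)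
  mu_ract : ∀ {x y z : C} (g : y ⟶ z) (h : x ⟶ y) (a b) (e : (corr g).s a = (corr h).r b)
    (k : (gpd x).Arr) (ek : (corr h).s b = (gpd x).r k),
    mu g h (.mk _ _ a ((corr h).ract b k ek) (e.trans ((corr h).r_ract b k ek).symm)) =
      (corr (h ≫ g)).ract (mu g h (.mk _ _ a b e)) k ((s_mu g h a b e).trans ek)
  unitor : (x : C) → (corr (𝟙 x)).carrier ≃ₜ (gpd x).Arr
  r_unitor : ∀ x η, (gpd x).r (unitor x η) = (corr (𝟙 x)).r η
  s_unitor : ∀ x η, (gpd x).s (unitor x η) = (corr (𝟙 x)).s η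
  unitor_lact : ∀ x k η (e : (gpd x).s k = (corr (𝟙 x)).r η),
    unitor x ((corr (𝟙 x)).lact k η e) =
      (gpd x).mul k (unitor x η) (e.trans (r_unitor x η).symm)
  unitor_ract : ∀ x η k (e : (corr (𝟙 x)).s η = (gpd x).r k),
    unitor x ((corr (𝟙 x)).ract η k e) =
      (gpd x).mul (unitor x η) k ((s_unitor x η).trans e)
  /-- `mu g (𝟙 x)` is the canonical isomorphism `[γ, η] ↦ γ · η`. -/
  mu_id : ∀ {x y : C} (g : x ⟶ y) (γ η) (e : (corr g).s γ = (corr (𝟙 x)).r η),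
    cast (congrArg (fun f => (corr f).carrier) (Category.id_comp g))
        (mu g (𝟙 x) (.mk _ _ γ η e)) =
      (corr g).ract γ (unitor x η) (e.trans (r_unitor x η).symm)
  /-- `mu (𝟙 y) g` is the canonical isomorphism `[η, γ] ↦ η · γ`. -/
  id_mu : ∀ {x y : C} (g : x ⟶ y) (η γ) (e : (corr (𝟙 y)).s η = (corr g).r γ),
    cast (congrArg (fun f => (corr f).carrier) (Category.comp_id g))
        (mu (𝟙 y) g (.mk _ _ η γ e)) =
      (corr g).lact (unitor y η) γ ((s_unitor y η).trans e)
  /-- The coherence condition for three composable arrows. -/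
  mu_assoc : ∀ {x₀ x₁ x₂ x₃ : C} (f : x₁ ⟶ x₀) (g : x₂ ⟶ x₁) (h : x₃ ⟶ x₂) (a b c)
    (e : (corr f).s a = (corr g).r b) (e' : (corr g).s b = (corr h).r c),
    cast (congrArg (fun k => (corr k).carrier) (Category.assoc h g f).symm)
        (mu (g ≫ f) h (.mk _ _ (mu f g (.mk _ _ a b e)) c ((s_mu f g a b e).trans e'))) =
      mu f (h ≫ g) (.mk _ _ a (mu g h (.mk _ _ b c e')) (e.trans (r_mu g h b c e').symm))

namespace Diagram

variable {C : Type v} [Category.{w} C]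

/-- A diagram is proper if all its correspondences are proper. -/
def IsProper (F : Diagram.{u} C) : Prop := ∀ {x y : C} (g : x ⟶ y), (F.corr g).IsProper

/-- A diagram is locally compact if all its groupoids and correspondences are locally compact. -/
class IsLocallyCompact (F : Diagram.{u} C) : Prop where
  gpd : ∀ x : C, (F.gpd x).IsLocallyCompact
  corr : ∀ {x y : C} (g : x ⟶ y), (F.corr g).IsLocallyCompact

/-- The disjoint union `⨆ₓ Gₓ⁰` of the object spaces. -/
abbrev Base (F : Diagram.{u} C) : Type (max u v) := Σ x : C, (F.gpd x).Obj

instance (F : Diagram.{u} C) [h : F.IsLocallyCompact] : T2Space F.Base :=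
  have := fun x => (h.gpd x).t2
  inferInstance

instance (F : Diagram.{u} C) [h : F.IsLocallyCompact] : LocallyCompactSpace F.Base := by
  have := fun x => (h.gpd x).locallyCompact
  have : WeaklyLocallyCompactSpace F.Base := ⟨fun ⟨x, b⟩ => by
    obtain ⟨K, hK, hb⟩ := exists_compact_mem_nhds b
    exact ⟨Sigma.mk x '' K, hK.image continuous_sigmaMk,
      IsOpenEmbedding.sigmaMk.image_mem_nhds.2 hb⟩⟩
  infer_instance

/-- An `F`-action on a space `Y`.  The partition of `Y` into clopen subsets `Y_x` with continuous
maps `Y_x → Gₓ⁰` is encoded by one continuous map `anchor` from `Y` to the disjoint union of the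
`Gₓ⁰`, so that `Y_x` is the preimage of `Gₓ⁰`; `anchor y = ⟨x, s γ⟩` says that `y ∈ Y_x` and
`r y = s γ`. -/
@[ext]
structure Action (F : Diagram.{u} C) (Y : Type t) [TopologicalSpace Y] where
  anchor : C(Y, F.Base)
  act : {x x' : C} → (g : x ⟶ x') → (γ : (F.corr g).carrier) → (y : Y) →
    anchor y = ⟨x, (F.corr g).s γ⟩ → Y
  /-- `γ · y` lies in `Y_{x'}` and `r (γ · y) = r γ`. -/
  anchor_act : ∀ {x x' : C} (g : x ⟶ x') (γ y) (e : anchor y = ⟨x, (F.corr g).s γ⟩),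
    anchor (act g γ y e) = ⟨x', (F.corr g).r γ⟩
  continuous_act : ∀ {x x' : C} (g : x ⟶ x'),
    Continuous fun p : {p : (F.corr g).carrier × Y // anchor p.2 = ⟨x, (F.corr g).s p.1⟩} =>
      act g p.1.1 p.1.2 p.2
  isOpenMap_act : ∀ {x x' : C} (g : x ⟶ x'),
    IsOpenMap fun p : {p : (F.corr g).carrier × Y // anchor p.2 = ⟨x, (F.corr g).s p.1⟩} =>
      act g p.1.1 p.1.2 p.2
  /-- The map `F_g ×_{s, Gₓ⁰, r} Y_x → Y_{x'}` is surjective. -/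
  surjective_act : ∀ {x x' : C} (g : x ⟶ x') (y : Y), (anchor y).1 = x' →
    ∃ (γ : (F.corr g).carrier) (z : Y) (e : anchor z = ⟨x, (F.corr g).s γ⟩), act g γ z e = y
  act_act : ∀ {x y z : C} (g : y ⟶ z) (h : x ⟶ y) (a b p)
    (e : (F.corr g).s a = (F.corr h).r b) (e' : anchor p = ⟨x, (F.corr h).s b⟩),
    act g a (act h b p e') ((anchor_act h b p e').trans (by rw [e])) =
      act (h ≫ g) (F.mu g h (.mk _ _ a b e)) p (e'.trans (by rw [F.s_mu g h a b e]))
  /-- If `γ · y = γ' · y'`, then `γ' = γ · η` and `y = η · y'` for some arrow `η` of `Gₓ`,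
  considered as an element of the correspondence of the identity arrow on `x`. -/
  exists_of_act_eq : ∀ {x x' : C} (g : x ⟶ x') (γ γ' y y')
    (e : anchor y = ⟨x, (F.corr g).s γ⟩) (e' : anchor y' = ⟨x, (F.corr g).s γ'⟩),
    act g γ y e = act g γ' y' e' →
    ∃ (η : (F.corr (𝟙 x)).carrier) (f : (F.corr g).s γ = (F.gpd x).r (F.unitor x η))
      (f' : anchor y' = ⟨x, (F.corr (𝟙 x)).s η⟩),
      γ' = (F.corr g).ract γ (F.unitor x η) f ∧ y = act (𝟙 x) η y' f'

/-- A map between spaces with `F`-actions is `F`-equivariant if it is continuous, is compatible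
with the partitions and anchor maps, and satisfies `φ (γ · y) = γ · φ y`. -/
structure IsEquivariant {F : Diagram.{u} C} {Y : Type t} {Y' : Type t'} [TopologicalSpace Y]
    [TopologicalSpace Y'] (A : F.Action Y) (A' : F.Action Y') (φ : Y → Y') : Prop where
  continuous : Continuous φ
  anchor : ∀ y, A'.anchor (φ y) = A.anchor y
  act : ∀ {x x' : C} (g : x ⟶ x') (γ y) (e : A.anchor y = ⟨x, (F.corr g).s γ⟩),
    φ (A.act g γ y e) = A'.act g γ (φ y) ((anchor y).trans e)

end Diagram

section RelStoneCech

variable {X : Type t} {B : Type v} [TopologicalSpace X] [TopologicalSpace B]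

/-- The C⋆-subalgebra `C_b(X) · r^*(C₀(B))` of `C_b(X)`, the closed linear span of the products
`f · (g ∘ r)` with `f ∈ C_b(X)`, `g ∈ C₀(B)`. -/
noncomputable def relStoneCechAlgebra (r : C(X, B)) : NonUnitalStarSubalgebra ℂ (X →ᵇ ℂ) :=
  (NonUnitalStarAlgebra.adjoin ℂ
    {k : X →ᵇ ℂ | ∃ (f : X →ᵇ ℂ) (g : C₀(B, ℂ)),
      k = f * g.toBCF.compContinuous r}).topologicalClosure

/-- The relative Stone–Čech compactification `β_B X` of `r : X → B`: the spectrum (the space of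
nonzero characters with the weak-⋆ topology) of `C_b(X) · r^*(C₀(B))`. -/
abbrev RelStoneCech (r : C(X, B)) : Type t :=
  WeakDual.characterSpace ℂ (relStoneCechAlgebra r)

/-- Some function in `C_b(X) · r^*(C₀(B))` does not vanish at a given point. -/
theorem exists_relStoneCechAlgebra_apply_ne_zero [T2Space B] [LocallyCompactSpace B] (r : C(X, B))
    (x : X) : ∃ k : relStoneCechAlgebra r, (k : X →ᵇ ℂ) x ≠ 0 := by
  obtain ⟨f, hf, -, hc, -⟩ := exists_continuous_one_zero_of_isCompact
    (isCompact_singleton (x := r x)) isClosed_empty (Set.disjoint_empty _)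
  let g : C₀(B, ℂ) :=
    { toFun := fun b => (f b : ℂ)
      continuous_toFun := Complex.continuous_ofReal.comp f.continuous
      zero_at_infty' :=
        (hc.comp_left (g := fun a : ℝ => (a : ℂ)) Complex.ofReal_zero).is_zero_at_infty }
  refine ⟨⟨1 * g.toBCF.compContinuous r, subset_closure
    (NonUnitalStarAlgebra.subset_adjoin ℂ _ ⟨1, g, rfl⟩)⟩, ?_⟩
  have h1 : f (r x) = 1 := hf rfl
  simp [g, h1]

/-- The canonical map `X → β_B X` that sends a point to the evaluation at that point. -/
noncomputable def RelStoneCech.of [T2Space B] [LocallyCompactSpace B] (r : C(X, B)) (x : X) :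
    RelStoneCech r :=
  ⟨(BoundedContinuousFunction.evalCLM ℂ x).comp
      (relStoneCechAlgebra r).toSubmodule.subtypeL, by
    refine ⟨fun h => ?_, fun k l => rfl⟩
    obtain ⟨k, hk⟩ := exists_relStoneCechAlgebra_apply_ne_zero r x
    exact hk (DFunLike.congr_fun h k)⟩

end RelStoneCech

/-! An action map for an arrow `g` amounts to two pieces of data: a continuous orbit map from
`Y_{x'}` to the orbit space of `F.corr g`, sending `γ · y` to `[γ]`, and the homeomorphism `(γ, y) ↦
(γ, γ · y)` from the fibre product of `F.corr g` with `Y_x` over `G_x⁰` to its fibre product with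
`Y_{x'}` over the orbit space. The inverse is division, and it is continuous because the action map
is open and the orbit projection is a local homeomorphism.

Both pieces extend to the compactification `Z`. Call a dense map `i : Y → Z` good if bounded
continuous functions on `Y` have limits at all points of `Z` (`ExtendsBounded`). A continuous map
over a base `B` from `Y` to a completely regular Hausdorff space that is proper over `B` then
extends to `Z` (`ExtendsBounded.exists_extension`). Goodness survives base change along local
homeomorphisms (`ExtendsBounded.baseChange`). The anchor `s`, the inclusion of `G_x⁰` and the orbit
projection are local homeomorphisms, so both fibre products inherit it. The action and division maps
extend because `Z` is proper over `G⁰`; the orbit map extends because the correspondence is proper.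

By density the extensions remain mutually inverse. Hence the extended action map is a homeomorphism
followed by a base change of the orbit projection, which makes it open and surjective and gives
condition (2). Associativity and uniqueness are identities between continuous maps on dense subsets.
-/

open Filter

/-! ### Fibre products: openness and density -/

section FibreProducts

variable {X Y Z B : Type*}

/-- The fibre product of `s : X → B` and `r : Y → B`. -/
abbrev FibreProduct (s : X → B) (r : Y → B) : Type _ := {p : X × Y // r p.2 = s p.1}

/-- The map of fibre products induced by a map `i : Y → Z` over `B`. -/
def FibreProduct.map {s : X → B} {r : Y → B} {r' : Z → B} (i : Y → Z) (h : ∀ y, r' (i y) = r y)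
    (p : FibreProduct s r) : FibreProduct s r' :=
  ⟨(p.1.1, i p.1.2), (h _).trans p.2⟩

variable [TopologicalSpace X] [TopologicalSpace Y] [TopologicalSpace Z]

theorem FibreProduct.continuous_map {s : X → B} {r : Y → B} {r' : Z → B} {i : Y → Z}
    (h : ∀ y, r' (i y) = r y) (hi : Continuous i) :
    Continuous (FibreProduct.map (s := s) i h) := by
  unfold FibreProduct.map
  fun_prop

/-- Neighbourhoods in a fibre product contain a restricted product of open sets. -/
theorem FibreProduct.exists_open_prod {s : X → B} {r : Y → B} {p : FibreProduct s r}
    {N : Set (FibreProduct s r)} (hN : N ∈ 𝓝 p) :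
    ∃ U : Set X, ∃ V : Set Y, IsOpen U ∧ IsOpen V ∧ p.1.1 ∈ U ∧ p.1.2 ∈ V ∧
      ∀ q : FibreProduct s r, q.1.1 ∈ U → q.1.2 ∈ V → q ∈ N := by
  obtain ⟨M, hM, hMN⟩ := mem_nhds_subtype _ _ _ |>.1 hN
  obtain ⟨U, V, hU, hpU, hV, hpV, hUV⟩ := mem_nhds_prod_iff'.1 hM
  exact ⟨U, V, hU, hV, hpU, hpV, fun q h1 h2 => hMN (hUV ⟨h1, h2⟩)⟩

variable [TopologicalSpace B]

theorem FibreProduct.isOpenMap_snd {s : X → B} {r : Y → B} (hs : IsOpenMap s)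
    (hr : Continuous r) : IsOpenMap fun p : FibreProduct s r => p.1.2 := by
  refine IsOpenMap.of_nhds_le fun p N hN => ?_
  obtain ⟨U, V, hU, hV, hpU, hpV, h⟩ := exists_open_prod (mem_map.1 hN)
  filter_upwards [hV.mem_nhds hpV,
    ((hs U hU).preimage hr).mem_nhds (show r p.1.2 ∈ s '' U from p.2 ▸ ⟨_, hpU, rfl⟩)]
    with y hy ⟨x, hx, hxy⟩
  exact h ⟨(x, y), hxy.symm⟩ hx hy

/-- Openness of `s` is what makes this work: for open `U` in `X` and `V` in `Z`, the part of `V`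
lying over `s '' U` is open, so it contains points of the dense image. -/
theorem FibreProduct.denseRange_map {X Y Z B : Type*} [TopologicalSpace X] [TopologicalSpace Z]
    [TopologicalSpace B] {s : X → B} {r : Y → B} {r' : Z → B} {i : Y → Z}
    (h : ∀ y, r' (i y) = r y) (hi : DenseRange i) (hs : IsOpenMap s) (hr' : Continuous r') :
    DenseRange (FibreProduct.map (s := s) i h) := by
  intro p
  refine mem_closure_iff_nhds.2 fun N hN => ?_
  obtain ⟨U, V, hU, hV, hpU, hpV, hUV⟩ := exists_open_prod hN
  obtain ⟨y, hyV, x, hx, hxy⟩ := hi.exists_mem_open (hV.inter ((hs U hU).preimage hr'))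
    ⟨p.1.2, hpV, _, hpU, p.2.symm⟩
  exact ⟨_, hUV (FibreProduct.map i h ⟨(x, y), (h y).symm.trans hxy.symm⟩) hx hyV, _, rfl⟩

end FibreProducts

/-! ### Separation properties and extension by density -/

theorem t35Space_of_locallyCompact (X : Type*) [TopologicalSpace X] [T2Space X]
    [LocallyCompactSpace X] : T35Space X where
  completely_regular x K hK hx := by
    obtain ⟨f, hf1, hf0, -, hf⟩ := exists_continuous_one_zero_of_isCompact
      (isCompact_singleton (x := x)) hK (Set.disjoint_singleton_left.2 hx)
    refine ⟨fun y => unitInterval.symm ⟨f y, hf y⟩,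
      unitInterval.continuous_symm.comp (f.continuous.subtype_mk _), ?_, fun y hy => ?_⟩
    · ext
      simp [hf1 rfl]
    · ext
      simp [hf0 hy]

theorem IsProperMap.locallyCompactSpace {X B : Type*} [TopologicalSpace X] [TopologicalSpace B]
    [T2Space X] [LocallyCompactSpace B] {f : X → B} (hf : IsProperMap f) :
    LocallyCompactSpace X := by
  have : WeaklyLocallyCompactSpace X := ⟨fun x => by
    obtain ⟨K, hK, hx⟩ := exists_compact_mem_nhds (f x)
    exact ⟨f ⁻¹' K, hf.isCompact_preimage hK, hf.continuous.continuousAt hx⟩⟩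
  infer_instance

/-- Two continuous maps into a Hausdorff space that agree on a dense range are equal. -/
theorem eq_of_denseRange {X Y Z : Type*} [TopologicalSpace Y] [TopologicalSpace Z] [T2Space Z]
    {j : X → Y} (hj : DenseRange j) {f g : Y → Z} (hf : Continuous f) (hg : Continuous g)
    (h : ∀ x, f (j x) = g (j x)) (y : Y) : f y = g y :=
  congrFun (hj.equalizer hf hg (funext h)) y

theorem DenseRange.comap_nhds_neBot {Y Z : Type*} [TopologicalSpace Z] {i : Y → Z}
    (hi : DenseRange i) (z : Z) : NeBot (comap i (𝓝 z)) :=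
  comap_neBot fun s hs => by
    rcases mem_closure_iff_nhds.1 (hi z) s hs with ⟨_, ha, a, rfl⟩
    exact ⟨a, ha⟩

theorem DenseRange.exists_extension {Y Z W : Type*} [TopologicalSpace Z] [TopologicalSpace W]
    [T3Space W] {i : Y → Z} (hi : DenseRange i) {φ : Y → W}
    (h : ∀ z, ∃ c, Tendsto φ (comap i (𝓝 z)) (𝓝 c)) :
    ∃ ψ : Z → W, Continuous ψ ∧ ∀ y, ψ (i y) = φ y := by
  -- `i` need not be inducing for the given topology of `Y`. Only limits along `comap i (𝓝 z)`
  -- matter, so the induced topology may replace it.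
  let : TopologicalSpace Y := .induced i inferInstance
  have di : IsDenseInducing i := ⟨⟨rfl⟩, hi⟩
  exact ⟨di.extend φ, di.continuous_extend h, di.extend_eq' h⟩

/-! ### Maps along which bounded continuous functions extend -/

/-- A continuous map with dense range such that every bounded continuous function on the domain
has limits at all points of the codomain. -/
structure ExtendsBounded {Y Z : Type*} [TopologicalSpace Y] [TopologicalSpace Z] (i : Y → Z) :
    Prop where
  continuous : Continuous i
  denseRange : DenseRange i
  exists_tendsto : ∀ (f : Y → ℝ), Continuous f → (∃ C, ∀ y, |f y| ≤ C) → ∀ z,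
    ∃ c, Tendsto f (comap i (𝓝 z)) (𝓝 c)

namespace ExtendsBounded

variable {X Y Z W B : Type*} [TopologicalSpace X] [TopologicalSpace Y] [TopologicalSpace Z]
  [TopologicalSpace W] [TopologicalSpace B] {i : Y → Z}

/-- A continuous map to a completely regular Hausdorff space extends if it has cluster points. -/
theorem exists_extension_of_ultrafilter [T35Space W] (hi : ExtendsBounded i) {φ : Y → W}
    (hφ : Continuous φ)
    (h : ∀ z, ∀ U : Ultrafilter Y, (U : Filter Y) ≤ comap i (𝓝 z) → ∃ c, Tendsto φ U (𝓝 c)) :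
    ∃ ψ : Z → W, Continuous ψ ∧ ∀ y, ψ (i y) = φ y := by
  have key : ∀ z, ∃ c, Tendsto φ (comap i (𝓝 z)) (𝓝 c) := by
    intro z
    have := hi.denseRange.comap_nhds_neBot z
    obtain ⟨c, hc⟩ := h z (Ultrafilter.of (comap i (𝓝 z))) (Ultrafilter.of_le _)
    refine ⟨c, (tendsto_iff_ultrafilter _ _ _).2 fun U hU => ?_⟩
    obtain ⟨d, hd⟩ := h z U hU
    suffices d = c by rwa [this] at hd
    by_contra hdc
    -- Distinct cluster points `c` and `d` would be separated by a bounded function `f`, but `f ∘ φ`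
    -- has only one limit at `z`.
    obtain ⟨f, hf, hfd, hfc⟩ := CompletelyRegularSpace.completely_regular d {c} isClosed_singleton
      (by simpa using hdc)
    have hf' : Continuous fun w => (f w : ℝ) := continuous_subtype_val.comp hf
    obtain ⟨l, hl⟩ := hi.exists_tendsto (fun y => (f (φ y) : ℝ)) (hf'.comp hφ)
      ⟨1, fun y => abs_le.2 ⟨by linarith [(f (φ y)).2.1], (f (φ y)).2.2⟩⟩ z
    have h1 := tendsto_nhds_unique (hl.mono_left (Ultrafilter.of_le _))
      ((hf'.tendsto c).comp hc)
    have h2 := tendsto_nhds_unique (hl.mono_left hU) ((hf'.tendsto d).comp hd)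
    have h3 : f c = 1 := hfc rfl
    rw [h1, hfd, h3] at h2
    norm_num at h2
  exact hi.denseRange.exists_extension key

/-- A continuous map over `B` to a space that is proper over `B` extends. -/
theorem exists_extension [T35Space W] (hi : ExtendsBounded i) {r : Z → B} (hr : Continuous r)
    {q : W → B} (hq : IsProperMap q) {φ : Y → W} (hφ : Continuous φ)
    (h : ∀ y, q (φ y) = r (i y)) : ∃ ψ : Z → W, Continuous ψ ∧ ∀ y, ψ (i y) = φ y := by
  refine hi.exists_extension_of_ultrafilter hφ fun z U hU => ?_
  have hqU : Tendsto q (U.map φ) (𝓝 (r z)) := by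
    rw [Ultrafilter.coe_map, tendsto_map'_iff]
    exact ((hr.tendsto z).comp (tendsto_comap.mono_left hU)).congr fun y => (h y).symm
  obtain ⟨c, -, hc⟩ := hq.ultrafilter_le_nhds_of_tendsto hqU
  exact ⟨c, hc⟩

/-- The property `ExtendsBounded` is stable under base change along local homeomorphisms. -/
theorem baseChange [CompletelyRegularSpace B] (hi : ExtendsBounded i) {r : Y → B} {r' : Z → B}
    (hr' : Continuous r') (h : ∀ y, r' (i y) = r y) {s : X → B} (hs : IsLocalHomeomorph s) :
    ExtendsBounded (FibreProduct.map (s := s) i h) where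
  continuous := FibreProduct.continuous_map h hi.continuous
  denseRange := FibreProduct.denseRange_map h hi.denseRange hs.isOpenMap hr'
  exists_tendsto := by
    classical
    rintro f hf ⟨C, hC⟩ ⟨⟨x, z⟩, hxz⟩
    dsimp only at hxz
    have hr : Continuous r := by
      rw [show r = r' ∘ i from funext fun y => (h y).symm]
      exact hr'.comp hi.continuous
    obtain ⟨e, hxe, rfl⟩ := hs x
    obtain ⟨g, hg, hg1, hg0, hgb⟩ : ∃ g : B → ℝ, Continuous g ∧ g (e x) = 1 ∧
        (∀ b ∉ e.target, g b = 0) ∧ ∀ b, |g b| ≤ 1 := by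
      obtain ⟨k, hk, hk0, hk1⟩ := CompletelyRegularSpace.completely_regular_isOpen (e x) e.target
        e.open_target (e.map_source hxe)
      refine ⟨fun b => 1 - k b, by fun_prop, by simp [hk0], fun b hb => ?_,
        fun b => abs_le.2 ⟨by linarith [(k b).2.2], by linarith [(k b).2.1]⟩⟩
      have : k b = 1 := hk1 hb
      simp [this]
    -- The local section `e.symm` of `s` pulls `f` back to the part of `Y` over `e.target`; the
    -- cutoff `g` lets it be extended by zero. Near `(x, z)`, `f` is recovered as `F / g`.
    let F : Y → ℝ := fun y => if hy : r y ∈ e.target then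
      g (r y) * f ⟨(e.symm (r y), y), (e.right_inv hy).symm⟩ else 0
    have hFC : ∀ y, |F y| ≤ |C| * |g (r y)| := by
      intro y
      by_cases hy : r y ∈ e.target
      · simp only [F, hy, dif_pos, abs_mul]
        rw [mul_comm]
        exact mul_le_mul_of_nonneg_right ((hC _).trans (le_abs_self C)) (abs_nonneg _)
      · simp only [F, hy, dif_neg, not_false_eq_true, abs_zero]
        positivity
    have hcut : Continuous fun y => g (r y) := by fun_prop
    have hFc : Continuous F := by
      refine continuous_iff_continuousAt.2 fun y => ?_
      by_cases hy : r y ∈ e.target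
      · have hO : IsOpen (r ⁻¹' e.target) := e.open_target.preimage hr
        refine ContinuousOn.continuousAt (s := r ⁻¹' e.target) ?_ (hO.mem_nhds hy)
        rw [continuousOn_iff_continuous_domRestrict]
        have : (r ⁻¹' e.target).domRestrict F = fun y : r ⁻¹' e.target =>
            g (r y) *
              f ⟨(e.symm (r y.1), y.1), (e.right_inv y.2).symm⟩ := by
          ext y
          exact dif_pos y.2
        rw [this]
        refine (hcut.comp continuous_subtype_val).mul (hf.comp ?_)
        refine Continuous.subtype_mk (Continuous.prodMk ?_ continuous_subtype_val) _
        exact e.continuousOn_symm.comp_continuous (hr.comp continuous_subtype_val) fun y => y.2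
      -- The cutoff is only known to vanish off the open set `e.target`, so continuity here comes
      -- from the bound `hFC`, whose right side tends to zero.
      · have hF0 : F y = 0 := dif_neg hy
        rw [ContinuousAt, hF0]
        refine squeeze_zero_norm hFC ?_
        have := ((hcut.abs.const_mul |C|).tendsto y)
        simpa [hg0 _ hy] using this
    obtain ⟨c, hc⟩ := hi.exists_tendsto F hFc ⟨|C|, fun y => (hFC y).trans
      (mul_le_of_le_one_right (abs_nonneg _) (hgb _))⟩ z
    refine ⟨c, ?_⟩
    set L := comap (FibreProduct.map (s := e) i h) (𝓝 ⟨(x, z), hxz⟩) with hL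
    have hLt : Tendsto (FibreProduct.map (s := e) i h) L (𝓝 ⟨(x, z), hxz⟩) := tendsto_comap
    have h1 : Tendsto (fun p : FibreProduct (e : X → B) r => p.1.1) L (𝓝 x) :=
      ((continuous_fst.comp continuous_subtype_val).tendsto _).comp hLt
    have h2 : Tendsto (fun p : FibreProduct (e : X → B) r => p.1.2) L (comap i (𝓝 z)) :=
      tendsto_comap_iff.2 (((continuous_snd.comp continuous_subtype_val).tendsto _).comp hLt)
    have h3 : Tendsto (fun p : FibreProduct (e : X → B) r => g (e p.1.1)) L (𝓝 1) := by
      rw [← hg1]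
      exact ((hg.tendsto _).comp (e.continuousAt hxe)).comp h1
    have h4 : Tendsto (fun p : FibreProduct (e : X → B) r =>
        F p.1.2 / g (e p.1.1)) L (𝓝 (c / 1)) := by
      exact (hc.comp h2).div h3 one_ne_zero
    rw [div_one] at h4
    refine h4.congr' ?_
    filter_upwards [h1 (e.open_source.mem_nhds hxe), h3 (lt_mem_nhds zero_lt_one)] with p hp hp'
    have hp0 : g (e p.1.1) ≠ 0 := ne_of_gt hp'
    have hpt : r p.1.2 ∈ e.target := p.2 ▸ e.map_source hp
    have hpe : (⟨(e.symm (r p.1.2), p.1.2), (e.right_inv hpt).symm⟩ :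
        FibreProduct (e : X → B) r) = p :=
      Subtype.ext (Prod.ext (by simp only [p.2]; exact e.left_inv hp) rfl)
    simp only [F, hpt, dif_pos, hpe]
    rw [p.2]
    field_simp

end ExtendsBounded

/-! ### The relative Stone–Čech compactification -/

namespace RelStoneCech

variable {X : Type t} {B : Type v} [TopologicalSpace X] [TopologicalSpace B] {r : C(X, B)}

/-- The generators absorb factors from `C_b(X)`. This ideal property lets the non-unital algebra
make use of units and inverses from `C_b(X)`. -/
theorem mul_mem_algebra (f : X →ᵇ ℂ) {a : X →ᵇ ℂ} (ha : a ∈ relStoneCechAlgebra r) :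
    f * a ∈ relStoneCechAlgebra r := by
  have key : ∀ a ∈ NonUnitalStarAlgebra.adjoin ℂ {k : X →ᵇ ℂ | ∃ (f : X →ᵇ ℂ) (g : C₀(B, ℂ)),
      k = f * g.toBCF.compContinuous r}, ∀ f : X →ᵇ ℂ,
      f * a ∈ NonUnitalStarAlgebra.adjoin ℂ {k : X →ᵇ ℂ | ∃ (f : X →ᵇ ℂ) (g : C₀(B, ℂ)),
        k = f * g.toBCF.compContinuous r} := by
    intro a ha
    induction ha using NonUnitalStarAlgebra.adjoin_induction with
    | mem x hx =>
      obtain ⟨h, g, rfl⟩ := hx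
      exact fun f => NonUnitalStarAlgebra.subset_adjoin ℂ _ ⟨f * h, g, (mul_assoc _ _ _).symm⟩
    | add x y _ _ hx hy => exact fun f => mul_add f x y ▸ add_mem (hx f) (hy f)
    | zero => exact fun f => (mul_zero f).symm ▸ zero_mem _
    | mul x y _ hy hx _ => exact fun f => mul_assoc f x y ▸ mul_mem (hx f) hy
    | smul c x _ hx => exact fun f => mul_smul_comm c f x ▸ SMulMemClass.smul_mem c (hx f)
    | star x _ hx =>
      intro f
      have := star_mem (hx (star f))
      rwa [star_mul, star_star, mul_comm] at this
  exact map_mem_closure (continuous_const_mul f) ha fun a ha => key a ha f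

theorem exists_isCompact_norm_lt {a : X →ᵇ ℂ} (ha : a ∈ relStoneCechAlgebra r) {ε : ℝ}
    (hε : 0 < ε) : ∃ K : Set B, IsCompact K ∧ ∀ x, r x ∉ K → ‖a x‖ < ε := by
  have key : ∀ a ∈ NonUnitalStarAlgebra.adjoin ℂ {k : X →ᵇ ℂ | ∃ (f : X →ᵇ ℂ) (g : C₀(B, ℂ)),
      k = f * g.toBCF.compContinuous r}, ∀ ε > 0,
      ∃ K : Set B, IsCompact K ∧ ∀ x, r x ∉ K → ‖a x‖ < ε := by
    intro a ha
    induction ha using NonUnitalStarAlgebra.adjoin_induction with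
    | mem a ha =>
      obtain ⟨f, g, rfl⟩ := ha
      intro ε hε
      have h1 : 0 < ε / (‖f‖ + 1) := by positivity
      have h2 := g.zero_at_infty'
      obtain ⟨K, hK, hg⟩ := mem_cocompact.1 (h2 (Metric.ball_mem_nhds 0 h1))
      refine ⟨K, hK, fun x hx => ?_⟩
      have h3 : ‖g (r x)‖ < ε / (‖f‖ + 1) := by simpa using hg hx
      rw [lt_div_iff₀ (by positivity)] at h3
      calc ‖f x * g (r x)‖ = ‖f x‖ * ‖g (r x)‖ := norm_mul _ _
        _ ≤ (‖f‖ + 1) * ‖g (r x)‖ := by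
          gcongr
          linarith [f.norm_coe_le_norm x]
        _ < ε := by rwa [mul_comm]
    | add a b _ _ ha hb =>
      intro ε hε
      obtain ⟨K, hK, h1⟩ := ha (ε / 2) (by positivity)
      obtain ⟨L, hL, h2⟩ := hb (ε / 2) (by positivity)
      refine ⟨K ∪ L, hK.union hL, fun x hx => ?_⟩
      have := h1 x fun h => hx (.inl h)
      have := h2 x fun h => hx (.inr h)
      exact (norm_add_le _ _).trans_lt (by linarith)
    | zero => exact fun ε hε => ⟨∅, isCompact_empty, fun x _ => by simpa using hε⟩
    | mul a b _ _ _ hb =>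
      intro ε hε
      obtain ⟨K, hK, h⟩ := hb (ε / (‖a‖ + 1)) (by positivity)
      refine ⟨K, hK, fun x hx => ?_⟩
      have h3 := h x hx
      rw [lt_div_iff₀ (by positivity)] at h3
      calc ‖a x * b x‖ = ‖a x‖ * ‖b x‖ := norm_mul _ _
        _ ≤ (‖a‖ + 1) * ‖b x‖ := by
          gcongr
          linarith [a.norm_coe_le_norm x]
        _ < ε := by rwa [mul_comm]
    | smul c a _ ha =>
      intro ε hε
      obtain ⟨K, hK, h⟩ := ha (ε / (‖c‖ + 1)) (by positivity)
      refine ⟨K, hK, fun x hx => ?_⟩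
      have h3 := h x hx
      rw [lt_div_iff₀ (by positivity)] at h3
      calc ‖c * a x‖ = ‖c‖ * ‖a x‖ := norm_mul _ _
        _ ≤ (‖c‖ + 1) * ‖a x‖ := by
          gcongr
          linarith
        _ < ε := by rwa [mul_comm]
    | star a _ ha => simpa using ha
  obtain ⟨b, hb, hab⟩ := Metric.mem_closure_iff.1 ha (ε / 2) (by positivity)
  obtain ⟨K, hK, h⟩ := key b hb (ε / 2) (by positivity)
  refine ⟨K, hK, fun x hx => ?_⟩
  have h1 := (BoundedContinuousFunction.dist_coe_le_dist x).trans_lt hab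
  rw [dist_eq_norm] at h1
  have := h x hx
  calc ‖a x‖ = ‖(a x - b x) + b x‖ := by simp
    _ ≤ ‖a x - b x‖ + ‖b x‖ := norm_add_le _ _
    _ < ε := by linarith

theorem continuous_eval (k : relStoneCechAlgebra r) : Continuous fun z : RelStoneCech r => z k :=
  (WeakDual.eval_continuous k).comp continuous_subtype_val

theorem exists_apply_ne_zero (z : RelStoneCech r) : ∃ k, z k ≠ 0 := by
  by_contra! h
  exact z.2.1 (ContinuousLinearMap.ext h)

theorem isInducing_eval :
    IsInducing fun (z : RelStoneCech r) (k : relStoneCechAlgebra r) => z k :=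
  (⟨rfl⟩ : IsInducing fun (z : WeakDual ℂ (relStoneCechAlgebra r)) k => z k).comp
    IsInducing.subtypeVal

variable [T2Space B] [LocallyCompactSpace B]

@[simp]
theorem of_apply (x : X) (k : relStoneCechAlgebra r) : of r x k = (k : X →ᵇ ℂ) x := rfl

theorem continuous_of : Continuous (of r) :=
  isInducing_eval.continuous_iff.2 (continuous_pi fun k => (k : X →ᵇ ℂ).continuous)

/-- If a basic neighbourhood of `z` contained no evaluation, finitely many differences `k - z k`
would have no approximate common zero on `X`. They would then generate the unit ideal of `C_b(X)`,
and `z` would vanish on the whole algebra. -/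
theorem denseRange_of : DenseRange (of r) := by
  intro z
  rw [isInducing_eval.closure_eq_preimage_closure_image, Set.mem_preimage, mem_closure_iff_nhds]
  intro N hN
  rw [nhds_pi, mem_pi'] at hN
  obtain ⟨I, T, hT, hTN⟩ := hN
  by_contra hne
  have hfar : ∀ x, ∃ k ∈ I, (k : X →ᵇ ℂ) x ∉ T k := by
    intro x
    by_contra! h
    exact hne ⟨_, hTN fun k hk => h k hk, _, ⟨x, rfl⟩, rfl⟩
  obtain ⟨ε, hε, hεT⟩ : ∃ ε > 0, ∀ k ∈ I, Metric.ball (z k) ε ⊆ T k := by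
    have : ∀ᶠ ε : ℝ in 𝓝[>] 0, ∀ k ∈ I, Metric.ball (z k) ε ⊆ T k := by
      rw [Filter.eventually_all_finset]
      intro k _
      obtain ⟨ε, hε, h⟩ := Metric.mem_nhds_iff.1 (hT k)
      filter_upwards [Ioo_mem_nhdsGT hε] with δ hδ
      exact (Metric.ball_subset_ball hδ.2.le).trans h
    obtain ⟨ε, h1, h2⟩ := (this.and self_mem_nhdsWithin).exists
    exact ⟨ε, h2, h1⟩
  let d : relStoneCechAlgebra r → X →ᵇ ℂ := fun k =>
    (k : X →ᵇ ℂ) - BoundedContinuousFunction.const X (z k)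
  let F : X →ᵇ ℂ := ∑ k ∈ I, d k * star (d k)
  have hF : ∀ x, F x = ((∑ k ∈ I, ‖d k x‖ ^ 2 : ℝ) : ℂ) := by
    intro x
    simp only [F, BoundedContinuousFunction.coe_sum, Finset.sum_apply]
    push_cast
    refine Finset.sum_congr rfl fun k _ => ?_
    simpa using Complex.mul_conj' (d k x)
  have hFε : ∀ x, ε ^ 2 ≤ ‖F x‖ := by
    intro x
    obtain ⟨k, hk, hx⟩ := hfar x
    have h1 : ε ≤ ‖d k x‖ := by
      by_contra! h
      exact hx (hεT k hk (by simpa [d, dist_eq_norm] using h))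
    rw [hF, Complex.norm_real]
    refine le_trans ?_ (le_abs_self _)
    exact (pow_le_pow_left₀ hε.le h1 2).trans
      (Finset.single_le_sum (f := fun k => ‖d k x‖ ^ 2) (fun _ _ => by positivity) hk)
  have hF0 : ∀ x, F x ≠ 0 := fun x h => by
    have := hFε x
    rw [h, norm_zero] at this
    exact absurd this (not_le.2 (by positivity))
  let E : X →ᵇ ℂ := BoundedContinuousFunction.ofNormedAddCommGroup (fun x => (F x)⁻¹)
    (F.continuous.inv₀ hF0) (ε ^ 2)⁻¹ fun x => by
      rw [norm_inv]
      exact inv_anti₀ (by positivity) (hFε x)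
  obtain ⟨a, ha⟩ := exists_apply_ne_zero z
  apply ha
  -- `E` inverts `F = ∑ d k * star (d k)`, so `a = ∑ d k * W k`. The factor `a` keeps each `W k` in
  -- the algebra, and `z` kills each term `k * W k - z k • W k`.
  let W : relStoneCechAlgebra r → relStoneCechAlgebra r := fun k =>
    ⟨star (d k) * E * a, mul_mem_algebra _ a.2⟩
  have hsum : a = ∑ k ∈ I, (k * W k - z k • W k) := by
    apply Subtype.ext
    ext x
    have h1 : F x * E x = 1 := mul_inv_cancel₀ (hF0 x)
    have h2 : ((∑ k ∈ I, (k * W k - z k • W k) : relStoneCechAlgebra r) : X →ᵇ ℂ) x =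
        F x * E x * (a : X →ᵇ ℂ) x := by
      simp only [F, AddSubmonoidClass.coe_finsetSum, BoundedContinuousFunction.coe_sum,
        Finset.sum_apply, Finset.sum_mul]
      refine Finset.sum_congr rfl fun k _ => ?_
      simp [W, d]
      ring
    rw [h2, h1, one_mul]
  rw [hsum, map_sum]
  exact Finset.sum_eq_zero fun k _ => by simp [map_sub, map_mul]

theorem tendsto_coe_comap (z : RelStoneCech r) (k : relStoneCechAlgebra r) :
    Tendsto (k : X →ᵇ ℂ) (comap (of r) (𝓝 z)) (𝓝 (z k)) :=
  ((continuous_eval k).tendsto z).comp tendsto_comap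

theorem norm_apply_le (z : RelStoneCech r) (k : relStoneCechAlgebra r) : ‖z k‖ ≤ ‖k‖ := by
  have := denseRange_of.comap_nhds_neBot z
  exact le_of_tendsto (tendsto_coe_comap z k).norm
    (Eventually.of_forall fun x => (k : X →ᵇ ℂ).norm_coe_le_norm x)

theorem extendsBounded_of : ExtendsBounded (of r) where
  continuous := continuous_of
  denseRange := denseRange_of
  exists_tendsto := by
    rintro f hf ⟨C, hC⟩ z
    obtain ⟨k, hk⟩ := exists_apply_ne_zero z
    -- `f` itself need not lie in the algebra, but `f * k` does. With `z k ≠ 0`, the limit of `f` is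
    -- `z (f * k) / z k`.
    let g : X →ᵇ ℂ := BoundedContinuousFunction.ofNormedAddCommGroup (fun x => (f x : ℂ))
      (Complex.continuous_ofReal.comp hf) C fun x => by simpa using hC x
    have h1 := tendsto_coe_comap z k
    have h2 := tendsto_coe_comap z ⟨g * k, mul_mem_algebra g k.2⟩
    refine ⟨_, ((Complex.continuous_re.tendsto _).comp (h2.div h1 hk)).congr' ?_⟩
    filter_upwards [h1.eventually_ne hk] with x hx
    have : g x * (k : X →ᵇ ℂ) x / (k : X →ᵇ ℂ) x = f x := mul_div_cancel_right₀ _ hx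
    simp [this]

/-- Some `k` has `z k ≠ 0`, while `k` is small off the preimage of a compact set `K`. Points of `X`
near `z` are thus sent into `K`, where ultrafilters converge. -/
theorem exists_anchor (r : C(X, B)) :
    ∃ s : C(RelStoneCech r, B), ∀ x, s (of r x) = r x := by
  have := t35Space_of_locallyCompact B
  have hlim : ∀ (z : RelStoneCech r) (U : Ultrafilter X), (U : Filter X) ≤ comap (of r) (𝓝 z) →
      ∃ c, Tendsto r U (𝓝 c) := by
    intro z U hU
    obtain ⟨k, hk⟩ := exists_apply_ne_zero z
    obtain ⟨K, hK, h⟩ := exists_isCompact_norm_lt k.2 (half_pos (norm_pos_iff.2 hk))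
    have h1 : ∀ᶠ x in comap (of r) (𝓝 z), r x ∈ K := by
      filter_upwards [(tendsto_coe_comap z k).norm (lt_mem_nhds (half_lt_self
        (norm_pos_iff.2 hk)))] with x hx
      by_contra hxK
      exact lt_asymm hx (h x hxK)
    obtain ⟨c, -, hc⟩ := hK.ultrafilter_le_nhds (U.map r) (le_principal_iff.2 (hU h1))
    exact ⟨c, hc⟩
  obtain ⟨s, hs, h⟩ := (extendsBounded_of (r := r)).exists_extension_of_ultrafilter
    r.continuous hlim
  exact ⟨⟨s, hs⟩, h⟩

/-- Characters lie in the weak-⋆ compact unit ball, so an ultrafilter has a limit there, which is a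
character or zero. Zero is excluded when the anchors converge to `b`: a compactly supported function
equal to `1` near `b` gives an element on which the characters are eventually `1`. -/
theorem isProperMap_anchor {s : C(RelStoneCech r, B)} (h : ∀ x, s (of r x) = r x) :
    IsProperMap s := by
  rw [isProperMap_iff_ultrafilter_of_t2]
  refine ⟨s.continuous, fun U b hb => ?_⟩
  obtain ⟨K, hK, hbK⟩ := exists_compact_mem_nhds b
  obtain ⟨f, hf, -, hc, -⟩ := exists_continuous_one_zero_of_isCompact hK isClosed_empty
    (Set.disjoint_empty _)
  let g : C₀(B, ℂ) :=
    { toFun := fun b => (f b : ℂ)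
      continuous_toFun := Complex.continuous_ofReal.comp f.continuous
      zero_at_infty' :=
        (hc.comp_left (g := fun a : ℝ => (a : ℂ)) Complex.ofReal_zero).is_zero_at_infty }
  let k : relStoneCechAlgebra r := ⟨1 * g.toBCF.compContinuous r, subset_closure
    (NonUnitalStarAlgebra.subset_adjoin ℂ _ ⟨1, g, rfl⟩)⟩
  have hk : ∀ z : RelStoneCech r, z k = g (s z) :=
    eq_of_denseRange denseRange_of (continuous_eval k) (g.continuous.comp s.continuous)
      fun x => by simp [k, h]
  have hball : ∀ z : RelStoneCech r, (z : WeakDual ℂ (relStoneCechAlgebra r)) ∈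
      WeakDual.toStrongDual ⁻¹' Metric.closedBall
        (0 : StrongDual ℂ (relStoneCechAlgebra r)) 1 := by
    intro z
    rw [Set.mem_preimage]
    exact mem_closedBall_zero_iff (E := StrongDual ℂ (relStoneCechAlgebra r)) |>.2 <| ContinuousLinearMap.opNorm_le_bound _ zero_le_one fun a => by
      simpa using norm_apply_le z a
  obtain ⟨φ, -, hφ⟩ := (WeakDual.isCompact_closedBall (0 : StrongDual ℂ (relStoneCechAlgebra r))
    1).ultrafilter_le_nhds (U.map Subtype.val)
      (le_principal_iff.2 (mem_map.2 (Eventually.of_forall fun z => hball z)))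
  have hφU : Tendsto (Subtype.val : RelStoneCech r → _) U (𝓝 φ) := hφ
  have hφ0 : φ ≠ 0 := by
    rintro rfl
    have h1 : Tendsto (fun z : RelStoneCech r => z k) U (𝓝 0) :=
      ((WeakDual.eval_continuous k).tendsto _).comp hφU
    have h2 : ∀ᶠ z in (U : Filter (RelStoneCech r)), z k = 1 := by
      filter_upwards [hb hbK] with z hz
      have : f (s z) = 1 := hf hz
      rw [hk]
      simp [g, this]
    exact zero_ne_one (tendsto_nhds_unique h1 (tendsto_const_nhds.congr'
      (h2.mono fun _ h => h.symm)))
  have hmem : φ ∈ WeakDual.characterSpace ℂ (relStoneCechAlgebra r) := by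
    have : φ ∈ WeakDual.characterSpace ℂ (relStoneCechAlgebra r) ∪ {0} :=
      (WeakDual.CharacterSpace.union_zero_isClosed ℂ (relStoneCechAlgebra r)).mem_of_tendsto hφU
        (Eventually.of_forall fun z => .inl z.2)
    exact this.resolve_right hφ0
  exact ⟨⟨φ, hmem⟩, tendsto_subtype_rng.2 hφU⟩

end RelStoneCech

/-! ### Étale groupoids and orbit spaces of correspondences -/

/-- An arrow `g` near a unit and the unit at `r g` have the same range, so local injectivity of `r`
identifies them. -/
theorem EtaleGroupoid.isOpen_range_unit (G : EtaleGroupoid.{u}) : IsOpen (Set.range G.unit) := by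
  refine isOpen_iff_mem_nhds.2 ?_
  rintro _ ⟨x, rfl⟩
  obtain ⟨N, hN, hxN, hinj⟩ := G.isLocalHomeomorph_r.isLocallyInjective (G.unit x)
  have h : Continuous fun g => G.unit (G.r g) :=
    G.continuous_unit.comp G.isLocalHomeomorph_r.continuous
  filter_upwards [hN.mem_nhds hxN, h.continuousAt.preimage_mem_nhds
    (hN.mem_nhds (show G.unit (G.r (G.unit x)) ∈ N by rwa [G.r_unit]))] with g hg hg'
  exact ⟨G.r g, hinj hg' hg (G.r_unit _)⟩

namespace Correspondence

variable {H G : EtaleGroupoid.{u}} (X : Correspondence H G)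

theorem ract_eq_self {x : X.carrier} {g : G.Arr} (e : X.s x = G.r g) (hg : g = G.unit (X.s x)) :
    X.ract x g e = x := by
  subst hg
  exact X.ract_unit x

theorem eq_unit_of_ract_eq {x : X.carrier} {g : G.Arr} {e : X.s x = G.r g}
    (h : X.ract x g e = x) : g = G.unit (X.s x) :=
  congrArg (fun p => p.1.2) (X.basic.injective (a₁ := ⟨(x, g), e⟩)
    (a₂ := ⟨(x, G.unit (X.s x)), (G.r_unit _).symm⟩)
      (Prod.ext (h.trans (X.ract_unit x).symm) rfl))

theorem mk_eq_mk_iff {x y : X.carrier} :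
    (Quotient.mk X.orbitSetoid x = Quotient.mk X.orbitSetoid y) ↔
      ∃ (g : G.Arr) (e : X.s x = G.r g), X.ract x g e = y :=
  Quotient.eq

/-- The saturation of an open set is the projection to `X` of its preimage under the action map, and
that projection is open as a base change of the range map of `G`. -/
theorem isOpenMap_mk : IsOpenMap (Quotient.mk X.orbitSetoid) := by
  intro U hU
  refine isOpen_coinduced.2 ?_
  have h1 : IsOpenMap fun p : {p : X.carrier × G.Arr // X.s p.1 = G.r p.2} => p.1.1 := by
    let f : {p : X.carrier × G.Arr // X.s p.1 = G.r p.2} ≃ₜ FibreProduct G.r X.s :=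
      (Homeomorph.prodComm _ _).subtype fun _ => Iff.rfl
    exact (FibreProduct.isOpenMap_snd G.isLocalHomeomorph_r.isOpenMap
      X.isLocalHomeomorph_s.continuous).comp f.isOpenMap
  convert h1 _ (hU.preimage X.continuous_ract)
  ext x
  constructor
  · rintro ⟨y, hy, hxy⟩
    obtain ⟨g, e, rfl⟩ := X.mk_eq_mk_iff.1 hxy.symm
    exact ⟨⟨(x, g), e⟩, hy, rfl⟩
  · rintro ⟨⟨⟨x, g⟩, e⟩, hp, rfl⟩
    exact ⟨_, hp, (X.mk_eq_mk_iff.2 ⟨g, e, rfl⟩).symm⟩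

theorem exists_open_injOn_mk (x : X.carrier) :
    ∃ U : Set X.carrier, IsOpen U ∧ x ∈ U ∧ Set.InjOn (Quotient.mk X.orbitSetoid) U := by
  -- Basicness turns the open set of units into an open neighbourhood `W` of the diagonal: two
  -- points of one orbit whose pair lies in `W` differ by a unit, hence coincide.
  obtain ⟨W, hW, hWeq⟩ := X.basic.isInducing.isOpen_iff.1
    (G.isOpen_range_unit.preimage (continuous_snd.comp continuous_subtype_val))
  have hWiff : ∀ (y : X.carrier) (g : G.Arr) (e : X.s y = G.r g),
      (X.ract y g e, y) ∈ W ↔ g ∈ Set.range G.unit := fun y g e => Set.ext_iff.1 hWeq ⟨(y, g), e⟩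
  have hxW : (x, x) ∈ W := by
    simpa [X.ract_unit] using (hWiff x (G.unit (X.s x)) (G.r_unit _).symm).2 ⟨X.s x, rfl⟩
  obtain ⟨U, V, hU, hxU, hV, hxV, hUV⟩ := mem_nhds_prod_iff'.1 (hW.mem_nhds hxW)
  refine ⟨U ∩ V, hU.inter hV, ⟨hxU, hxV⟩, fun y hy z hz hyz => ?_⟩
  obtain ⟨g, e, rfl⟩ := X.mk_eq_mk_iff.1 hyz
  obtain ⟨a, rfl⟩ := (hWiff y g e).1 (hUV ⟨hz.1, hy.2⟩)
  refine (X.ract_eq_self e ?_).symm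
  rw [e, G.r_unit]

theorem isLocalHomeomorph_mk : IsLocalHomeomorph (Quotient.mk X.orbitSetoid) := by
  refine isLocalHomeomorph_iff_isOpenEmbedding_restrict.2 fun x => ?_
  obtain ⟨U, hU, hxU, hinj⟩ := X.exists_open_injOn_mk x
  exact ⟨U, hU.mem_nhds hxU, .of_continuous_injective_isOpenMap
    (continuous_quotient_mk'.comp continuous_subtype_val) (Set.injOn_iff_injective.1 hinj)
    (X.isOpenMap_mk.comp hU.isOpenMap_subtype_val)⟩

end Correspondence

/-! ### Algebra of `F`-actions -/

namespace Diagram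

variable {C : Type v} [Category.{w} C] {F : Diagram.{u} C}

/-- The map `F_g → G⁰` into the disjoint union of the object spaces induced by `s`. -/
def source {x x' : C} (g : x ⟶ x') (γ : (F.corr g).carrier) : F.Base := ⟨x, (F.corr g).s γ⟩

/-- The map `F_g → G⁰` into the disjoint union of the object spaces induced by `r`. -/
def range {x x' : C} (g : x ⟶ x') (γ : (F.corr g).carrier) : F.Base := ⟨x', (F.corr g).r γ⟩

theorem isLocalHomeomorph_source {x x' : C} (g : x ⟶ x') :
    IsLocalHomeomorph (source (F := F) g) :=
  (IsOpenEmbedding.sigmaMk (σ := fun x => (F.gpd x).Obj)).isLocalHomeomorph.comp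
    (F.corr g).isLocalHomeomorph_s

theorem continuous_range {x x' : C} (g : x ⟶ x') : Continuous (range (F := F) g) :=
  continuous_sigmaMk.comp (F.corr g).continuous_r

/-- The data of an `F`-action except for the topological conditions and condition (2). -/
structure PreAction (F : Diagram.{u} C) (Y : Type t) where
  anchor : Y → F.Base
  act : {x x' : C} → (g : x ⟶ x') → (γ : (F.corr g).carrier) → (y : Y) →
    anchor y = ⟨x, (F.corr g).s γ⟩ → Y
  anchor_act : ∀ {x x' : C} (g : x ⟶ x') (γ y) (e : anchor y = ⟨x, (F.corr g).s γ⟩),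
    anchor (act g γ y e) = ⟨x', (F.corr g).r γ⟩
  act_act : ∀ {x y z : C} (g : y ⟶ z) (h : x ⟶ y) (a b p)
    (e : (F.corr g).s a = (F.corr h).r b) (e' : anchor p = ⟨x, (F.corr h).s b⟩),
    act g a (act h b p e') ((anchor_act h b p e').trans (by rw [e])) =
      act (h ≫ g) (F.mu g h (.mk _ _ a b e)) p (e'.trans (by rw [F.s_mu g h a b e]))

namespace PreAction

variable {Y : Type t} (A : F.PreAction Y)

theorem act_cast {x x' : C} {g h : x ⟶ x'} (hgh : g = h) {γ : (F.corr g).carrier}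
    {δ : (F.corr h).carrier} (hγδ : cast (congrArg (fun f => (F.corr f).carrier) hgh) γ = δ)
    {y : Y} (e : A.anchor y = ⟨x, (F.corr g).s γ⟩) (e' : A.anchor y = ⟨x, (F.corr h).s δ⟩) :
    A.act g γ y e = A.act h δ y e' := by
  subst hgh
  subst hγδ
  rfl

/-- The identity `(γ · η) · y = γ · (η · y)` for an arrow `η`. -/
theorem act_ract {x x' : C} (g : x ⟶ x') (γ : (F.corr g).carrier) (η : (F.corr (𝟙 x)).carrier)
    (y : Y) (f : (F.corr g).s γ = (F.gpd x).r (F.unitor x η))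
    (e : A.anchor y = ⟨x, (F.corr (𝟙 x)).s η⟩) :
    A.act g ((F.corr g).ract γ (F.unitor x η) f) y
        (e.trans (by rw [(F.corr g).s_ract, F.s_unitor])) =
      A.act g γ (A.act (𝟙 x) η y e)
        ((A.anchor_act _ _ _ _).trans (by rw [f, F.r_unitor])) := by
  have f' := f.trans (F.r_unitor x η)
  rw [A.act_act g (𝟙 x) γ η y f' e]
  exact (A.act_cast (Category.id_comp g) (F.mu_id g γ η f') _ _).symm

/-- Units act identically on points of the form `ζ · y`. -/
theorem unit_act_act {x : C} (η ζ : (F.corr (𝟙 x)).carrier) (y : Y)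
    (hη : F.unitor x η = (F.gpd x).unit ((F.corr (𝟙 x)).r ζ))
    (e : A.anchor y = ⟨x, (F.corr (𝟙 x)).s ζ⟩)
    (e' : A.anchor (A.act (𝟙 x) ζ y e) = ⟨x, (F.corr (𝟙 x)).s η⟩) :
    A.act (𝟙 x) η (A.act (𝟙 x) ζ y e) e' = A.act (𝟙 x) ζ y e := by
  have f : (F.corr (𝟙 x)).s η = (F.corr (𝟙 x)).r ζ := by
    rw [← F.s_unitor, hη, (F.gpd x).s_unit]
  rw [A.act_act (𝟙 x) (𝟙 x) η ζ y f e]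
  refine A.act_cast (Category.comp_id (𝟙 x)) ((F.id_mu (𝟙 x) η ζ f).trans ?_) _ _
  have : ∀ (k : (F.gpd x).Arr) (hk : (F.gpd x).s k = (F.corr (𝟙 x)).r ζ),
      k = (F.gpd x).unit ((F.corr (𝟙 x)).r ζ) → (F.corr (𝟙 x)).lact k ζ hk = ζ := by
    rintro k hk rfl
    exact (F.corr (𝟙 x)).unit_lact ζ
  exact this _ _ hη

end PreAction

namespace Action

variable {Y : Type t} [TopologicalSpace Y] (A : F.Action Y)

/-- The algebraic part of an `F`-action. -/
def toPreAction : F.PreAction Y where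
  anchor := A.anchor
  act := A.act
  anchor_act := A.anchor_act
  act_act := A.act_act

/-- Triviality of units is not an axiom. Surjectivity for the identity arrow writes `y` as `ζ · z`,
and the unit is absorbed into `ζ`. -/
theorem unit_act {x : C} (η : (F.corr (𝟙 x)).carrier) (y : Y) (b : (F.gpd x).Obj)
    (hη : F.unitor x η = (F.gpd x).unit b) (e : A.anchor y = ⟨x, (F.corr (𝟙 x)).s η⟩) :
    A.act (𝟙 x) η y e = y := by
  obtain ⟨ζ, z, f, rfl⟩ := A.surjective_act (𝟙 x) y (by rw [e])
  refine A.toPreAction.unit_act_act η ζ z ?_ f e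
  have h1 : (F.corr (𝟙 x)).r ζ = (F.corr (𝟙 x)).s η :=
    eq_of_heq (Sigma.mk.inj ((A.anchor_act _ _ _ f).symm.trans e)).2
  rw [hη, h1, ← F.s_unitor, hη, (F.gpd x).s_unit]

/-- Condition (2) with equal correspondence elements yields `η` with `γ · η = γ`; the right action
is free, so `η` is a unit and acts trivially. -/
theorem act_left_injective {x x' : C} (g : x ⟶ x') {γ : (F.corr g).carrier} {y z : Y}
    (e : A.anchor y = ⟨x, (F.corr g).s γ⟩) (e' : A.anchor z = ⟨x, (F.corr g).s γ⟩)
    (h : A.act g γ y e = A.act g γ z e') : y = z := by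
  obtain ⟨η, f, f', h1, rfl⟩ := A.exists_of_act_eq g γ γ y z e e' h
  exact A.unit_act η z _ ((F.corr g).eq_unit_of_ract_eq h1.symm) f'

theorem mk_eq_mk_of_act_eq {x x' : C} (g : x ⟶ x') {γ δ : (F.corr g).carrier} {y z : Y}
    (e : A.anchor y = ⟨x, (F.corr g).s γ⟩) (e' : A.anchor z = ⟨x, (F.corr g).s δ⟩)
    (h : A.act g γ y e = A.act g δ z e') :
    Quotient.mk (F.corr g).orbitSetoid γ = Quotient.mk (F.corr g).orbitSetoid δ := by
  obtain ⟨η, f, f', h1, -⟩ := A.exists_of_act_eq g γ δ y z e e' h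
  exact (F.corr g).mk_eq_mk_iff.2 ⟨_, f, h1.symm⟩

end Action

end Diagram

/-! ### Orbit and division maps of an action -/

namespace Diagram

variable {C : Type v} [Category.{w} C] {F : Diagram.{u} C}

/-- The inclusion `G_x⁰ → G⁰`. -/
def incl (F : Diagram.{u} C) (x : C) (b : (F.gpd x).Obj) : F.Base := ⟨x, b⟩

theorem isOpenEmbedding_incl (F : Diagram.{u} C) (x : C) : IsOpenEmbedding (F.incl x) :=
  IsOpenEmbedding.sigmaMk (σ := fun x => (F.gpd x).Obj)

theorem orbitSpace_t35Space [hL : F.IsLocallyCompact] (hF : F.IsProper) {x x' : C} (g : x ⟶ x') :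
    T35Space (F.corr g).OrbitSpace := by
  have := (hL.gpd x').locallyCompact
  have := (hL.corr g).t2
  have := (hF g).locallyCompactSpace
  exact t35Space_of_locallyCompact _

namespace Action

variable {Y : Type t} [TopologicalSpace Y] (A : F.Action Y)

/-- The action map `F_g ×_{s, r} Y → Y_{x'}`, where `Y_{x'}` is written as a fibre product. -/
def actFibre {x x' : C} (g : x ⟶ x') (p : FibreProduct (source g) A.anchor) :
    FibreProduct (F.incl x') A.anchor :=
  ⟨((F.corr g).r p.1.1, A.act g p.1.1 p.1.2 p.2), A.anchor_act _ _ _ _⟩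

theorem continuous_actFibre {x x' : C} (g : x ⟶ x') : Continuous (A.actFibre g) :=
  ((((F.corr g).continuous_r.comp continuous_fst).comp continuous_subtype_val).prodMk
    (A.continuous_act g)).subtype_mk _

theorem isOpenMap_actFibre {x x' : C} (g : x ⟶ x') : IsOpenMap (A.actFibre g) := by
  intro N hN
  convert (A.isOpenMap_act g N hN).preimage (f := fun p : FibreProduct
    (F.incl x') A.anchor => p.1.2) (by fun_prop)
  ext ⟨⟨b, y⟩, e⟩
  constructor
  · rintro ⟨p, hp, hpe⟩
    exact ⟨p, hp, congrArg (fun p => p.1.2) hpe⟩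
  · rintro ⟨p, hp, hpe⟩
    dsimp only at hpe
    subst hpe
    refine ⟨p, hp, Subtype.ext (Prod.ext ?_ rfl)⟩
    exact eq_of_heq (Sigma.mk.inj ((A.anchor_act _ _ _ p.2).symm.trans e)).2

theorem surjective_actFibre {x x' : C} (g : x ⟶ x') : Function.Surjective (A.actFibre g) := by
  rintro ⟨⟨b, y⟩, e⟩
  obtain ⟨γ, z, f, rfl⟩ := A.surjective_act g y (congrArg Sigma.fst e)
  refine ⟨⟨(γ, z), f⟩, Subtype.ext (Prod.ext ?_ rfl)⟩
  exact eq_of_heq (Sigma.mk.inj ((A.anchor_act _ _ _ f).symm.trans e)).2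

/-- The map `Y_{x'} → F_g / G_x`, `γ · y ↦ [γ]`. -/
theorem exists_orbit {x x' : C} (g : x ⟶ x') :
    ∃ π : FibreProduct (F.incl x') A.anchor → (F.corr g).OrbitSpace,
      Continuous π ∧ ∀ p, π (A.actFibre g p) = Quotient.mk _ p.1.1 := by
  have hq := (A.isOpenMap_actFibre g).isQuotientMap (A.continuous_actFibre g)
    (A.surjective_actFibre g)
  let f : C(FibreProduct (source g) A.anchor, (F.corr g).OrbitSpace) :=
    ⟨fun p => Quotient.mk _ p.1.1, continuous_quotient_mk'.comp (by fun_prop)⟩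
  have hf : Function.FactorsThrough f (A.actFibre g) := fun p q hpq =>
    A.mk_eq_mk_of_act_eq g p.2 q.2 (congrArg (fun p => p.1.2) hpq)
  let a : C(FibreProduct (source g) A.anchor,
    FibreProduct (F.incl x') A.anchor) :=
      ⟨A.actFibre g, A.continuous_actFibre g⟩
  have ha : IsQuotientMap a := hq
  exact ⟨ha.lift f hf, (ha.lift f hf).continuous, fun p =>
    DFunLike.congr_fun (ha.lift_comp f hf) p⟩

/-- The continuous map `(γ, γ · y) ↦ y`. -/
theorem exists_division {x x' : C} (g : x ⟶ x')
    {π : FibreProduct (F.incl x') A.anchor → (F.corr g).OrbitSpace}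
    (hπ : ∀ p, π (A.actFibre g p) = Quotient.mk _ p.1.1) :
    ∃ ψ : FibreProduct (Quotient.mk (F.corr g).orbitSetoid) π → Y, Continuous ψ ∧
      ∀ q, ∃ e : A.anchor (ψ q) = source g q.1.1,
        A.actFibre g ⟨(q.1.1, ψ q), e⟩ = q.1.2 := by
  have hex : ∀ q : FibreProduct (Quotient.mk (F.corr g).orbitSetoid) π,
      ∃ y, ∃ e : A.anchor y = source g q.1.1, A.actFibre g ⟨(q.1.1, y), e⟩ = q.1.2 := by
    rintro ⟨⟨γ, y'⟩, hq⟩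
    obtain ⟨⟨⟨δ, z⟩, hz⟩, rfl⟩ := A.surjective_actFibre g y'
    dsimp only at hz hq ⊢
    rw [hπ] at hq
    -- With `y' = δ · z` and `δ = γ · η`, the quotient of `y'` by `γ` is `η · z`.
    obtain ⟨k, e, rfl⟩ := (F.corr g).mk_eq_mk_iff.1 hq.symm
    obtain ⟨η, rfl⟩ := (F.unitor x).surjective k
    have f : A.anchor z = ⟨x, (F.corr (𝟙 x)).s η⟩ := by
      refine hz.trans ?_
      simp only [source, (F.corr g).s_ract, F.s_unitor]
    refine ⟨A.act (𝟙 x) η z f, (A.anchor_act _ _ _ _).trans ?_, ?_⟩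
    · rw [source, e, F.r_unitor]
    · exact Subtype.ext (Prod.ext ((F.corr g).r_ract _ _ _).symm
        (A.toPreAction.act_ract g γ η z e f).symm)
  choose ψ hψ hψ' using hex
  refine ⟨ψ, continuous_iff_continuousAt.2 fun q V hV => ?_, fun q => ⟨hψ q, hψ' q⟩⟩
  obtain ⟨U, hU, hqU, hinj⟩ := (F.corr g).exists_open_injOn_mk q.1.1
  have hN : {p : FibreProduct (source g) A.anchor | p.1.1 ∈ U ∧ p.1.2 ∈ V} ∈
      𝓝 ⟨(q.1.1, ψ q), hψ q⟩ :=
    inter_mem ((continuous_fst.comp continuous_subtype_val).continuousAt (hU.mem_nhds hqU))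
      ((continuous_snd.comp continuous_subtype_val).continuousAt hV)
  -- By openness, points near `q.1.2` are of the form `δ · y` with `δ ∈ U` and `y ∈ V`. Injectivity
  -- of the orbit projection on `U` forces `δ` to be the given first coordinate, so `y` is the value
  -- of `ψ`.
  have hN' := (A.isOpenMap_actFibre g).image_mem_nhds hN
  rw [hψ'] at hN'
  have hN₁ : ∀ᶠ p in 𝓝 q, p.1.1 ∈ U :=
    (continuous_fst.comp continuous_subtype_val).continuousAt (hU.mem_nhds hqU)
  have hN₂ : ∀ᶠ p in 𝓝 q, p.1.2 ∈ A.actFibre g '' {p | p.1.1 ∈ U ∧ p.1.2 ∈ V} :=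
    (continuous_snd.comp continuous_subtype_val).continuousAt hN'
  refine mem_map.2 ?_
  filter_upwards [hN₁, hN₂] with p hpU hpN
  obtain ⟨a, ⟨haU, haV⟩, hap⟩ := hpN
  have h1 : a.1.1 = p.1.1 := hinj haU hpU (by
    rw [← hπ, hap]
    exact p.2)
  obtain ⟨⟨γ, y⟩, e⟩ := a
  dsimp only at h1
  subst h1
  have h2 : y = ψ p := A.act_left_injective g e (hψ p)
    (congrArg (fun p => p.1.2) (hap.trans (hψ' p).symm))
  rw [Set.mem_preimage, ← h2]
  exact haV

/-! ### Extension of the action -/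

section Extension

variable {Z : Type t'} [TopologicalSpace Z] {i : Y → Z} {r : C(Z, F.Base)}

/-- The action map of an arrow extends, and the extension `m` has a continuous division map. -/
theorem exists_extension_act [hL : F.IsLocallyCompact] (hF : F.IsProper) [T35Space Z]
    (hi : ExtendsBounded i) (hr : IsProperMap r) (h : ∀ y, r (i y) = A.anchor y) {x x' : C}
    (g : x ⟶ x') :
    ∃ (m : FibreProduct (source g) r → Z) (hm : ∀ p, r (m p) = range g p.1.1)
      (π : FibreProduct (F.incl x') r → (F.corr g).OrbitSpace)
      (hπ : ∀ p : FibreProduct (source g) r, π ⟨((F.corr g).r p.1.1, m p), hm p⟩ = Quotient.mk _ p.1.1)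
      (ψ : FibreProduct (Quotient.mk (F.corr g).orbitSetoid) π → Z)
      (hψ : ∀ q, r (ψ q) = source g q.1.1),
      Continuous m ∧ Continuous π ∧ Continuous ψ ∧
      (∀ p, m (FibreProduct.map i h p) = i (A.act g p.1.1 p.1.2 p.2)) ∧
      (∀ p : FibreProduct (source g) r, ψ ⟨(p.1.1, ⟨((F.corr g).r p.1.1, m p), hm p⟩), hπ p⟩ = p.1.2) ∧
      ∀ q, m ⟨(q.1.1, ψ q), hψ q⟩ = q.1.2.1.2 := by
  have := t35Space_of_locallyCompact F.Base
  have := orbitSpace_t35Space hF g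
  have hrange : Continuous fun p : FibreProduct (source g) r => range g p.1.1 :=
    (continuous_range g).comp (by fun_prop)
  have hiP := hi.baseChange r.continuous h (isLocalHomeomorph_source g)
  have hiF := hi.baseChange r.continuous h (F.isOpenEmbedding_incl x').isLocalHomeomorph
  obtain ⟨m, hmc, hmi⟩ := hiP.exists_extension hrange hr
    (hi.continuous.comp (A.continuous_act g)) fun p => (h _).trans (A.anchor_act _ _ _ p.2)
  have hm : ∀ p, r (m p) = range g p.1.1 :=
    eq_of_denseRange hiP.denseRange (r.continuous.comp hmc) hrange fun p => by
      rw [hmi]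
      exact (h _).trans (A.anchor_act _ _ _ p.2)
  obtain ⟨π₀, hπ₀c, hπ₀⟩ := A.exists_orbit g
  -- Here properness of the correspondence enters: its orbit space is the target and `orbitMap` is
  -- the proper map.
  obtain ⟨π, hπc, hπi⟩ := hiF.exists_extension (r := fun p => p.1.1) (by fun_prop) (hF g) hπ₀c
    fun y => by
      obtain ⟨p, rfl⟩ := A.surjective_actFibre g y
      rw [hπ₀]
      rfl
  let mF : FibreProduct (source g) r →
      FibreProduct (F.incl x') r :=
    fun p => ⟨((F.corr g).r p.1.1, m p), hm p⟩
  have hmF : Continuous mF :=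
    (((F.corr g).continuous_r.comp (by fun_prop)).prodMk hmc).subtype_mk _
  have hmFi : ∀ p, mF (FibreProduct.map i h p) = FibreProduct.map i h (A.actFibre g p) :=
    fun p => Subtype.ext (Prod.ext rfl (hmi p))
  have hπ : ∀ p, π (mF p) = Quotient.mk _ p.1.1 :=
    eq_of_denseRange hiP.denseRange (hπc.comp hmF) (continuous_quotient_mk'.comp (by fun_prop))
      fun p => by
        rw [hmFi, hπi, hπ₀]
        rfl
  have hiQ := hiF.baseChange hπc hπi (F.corr g).isLocalHomeomorph_mk
  obtain ⟨ψ₀, hψ₀c, hψ₀⟩ := A.exists_division g hπ₀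
  choose hψ₀a hψ₀m using hψ₀
  have hsource : Continuous fun q : FibreProduct (Quotient.mk (F.corr g).orbitSetoid) π =>
    source g q.1.1 := (isLocalHomeomorph_source g).continuous.comp (by fun_prop)
  obtain ⟨ψ, hψc, hψi⟩ := hiQ.exists_extension hsource hr (hi.continuous.comp hψ₀c)
    fun q => (h _).trans (hψ₀a q)
  have hψ : ∀ q, r (ψ q) = source g q.1.1 :=
    eq_of_denseRange hiQ.denseRange (r.continuous.comp hψc) hsource fun q => by
      rw [hψi]
      exact (h _).trans (hψ₀a q)
  refine ⟨m, hm, π, hπ, ψ, hψ, hmc, hπc, hψc, hmi, ?_, ?_⟩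
  · refine eq_of_denseRange hiP.denseRange (hψc.comp (Continuous.subtype_mk
      (Continuous.prodMk (by fun_prop) hmF) _)) (by fun_prop) fun p => ?_
    let q : FibreProduct (Quotient.mk (F.corr g).orbitSetoid) π₀ :=
      ⟨(p.1.1, A.actFibre g p), hπ₀ p⟩
    have h1 : ψ₀ q = p.1.2 := A.act_left_injective g (hψ₀a q) p.2
      (congrArg (fun p => p.1.2) (hψ₀m q))
    have h2 : ∀ e, (⟨(p.1.1, mF (FibreProduct.map i h p)), e⟩ :
        FibreProduct (Quotient.mk (F.corr g).orbitSetoid) π) =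
          FibreProduct.map (FibreProduct.map i h) hπi q :=
      fun _ => Subtype.ext (Prod.ext rfl (hmFi p))
    exact (congrArg ψ (h2 _)).trans ((hψi q).trans (congrArg i h1))
  · refine eq_of_denseRange hiQ.denseRange (hmc.comp (Continuous.subtype_mk
      (Continuous.prodMk (by fun_prop) hψc) _)) (by fun_prop) fun q => ?_
    have h1 : ∀ e, (⟨(q.1.1, ψ (FibreProduct.map (FibreProduct.map i h) hπi q)), e⟩ :
        FibreProduct (source g) r) = FibreProduct.map i h ⟨(q.1.1, ψ₀ q), hψ₀a q⟩ :=
      fun _ => Subtype.ext (Prod.ext rfl (hψi q))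
    exact (congrArg m (h1 _)).trans ((hmi ⟨(q.1.1, ψ₀ q), hψ₀a q⟩).trans
      (congrArg (fun y : FibreProduct (F.incl x') A.anchor => i y.1.2) (hψ₀m q)))

/-- The extension of the action map of an arrow, with the properties required of an action. -/
theorem exists_extension_act_isOpenMap [hL : F.IsLocallyCompact] (hF : F.IsProper) [T35Space Z]
    (hi : ExtendsBounded i) (hr : IsProperMap r) (h : ∀ y, r (i y) = A.anchor y) {x x' : C}
    (g : x ⟶ x') :
    ∃ m : FibreProduct (source g) r → Z, Continuous m ∧ IsOpenMap m ∧
      (∀ p, r (m p) = range g p.1.1) ∧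
      (∀ p, m (FibreProduct.map i h p) = i (A.act g p.1.1 p.1.2 p.2)) ∧
      (∀ z, (r z).1 = x' → ∃ p, m p = z) ∧
      (∀ p q, m p = m q → Quotient.mk (F.corr g).orbitSetoid p.1.1 = Quotient.mk _ q.1.1) ∧
      ∀ p q, m p = m q → p.1.1 = q.1.1 → p = q := by
  obtain ⟨m, hm, π, hπ, ψ, hψ, hmc, hπc, hψc, hmi, hψm, hmψ⟩ :=
    A.exists_extension_act hF hi hr h g
  have hfib : ∀ p q, m p = m q →
      (⟨((F.corr g).r p.1.1, m p), hm p⟩ :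
        FibreProduct (F.incl x') r) =
      ⟨((F.corr g).r q.1.1, m q), hm q⟩ := fun p q hpq => by
    refine Subtype.ext (Prod.ext ?_ hpq)
    have := (hm p).symm.trans ((congrArg r hpq).trans (hm q))
    exact eq_of_heq (Sigma.mk.inj this).2
  refine ⟨m, hmc, ?_, hm, hmi, ?_, ?_, ?_⟩
  · intro N hN
    have hO : IsOpen {q : FibreProduct (Quotient.mk (F.corr g).orbitSetoid) π |
        (⟨(q.1.1, ψ q), hψ q⟩ : FibreProduct (source g) r) ∈ N} :=
      hN.preimage (Continuous.subtype_mk (Continuous.prodMk (by fun_prop) hψc) _)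
    -- Via division, `m` becomes the projection of the fibre product over the orbit space, followed
    -- by the projection to `Z`; both are base changes of open maps.
    have hO' := FibreProduct.isOpenMap_snd (F.isOpenEmbedding_incl x').isOpenMap r.continuous _
      (FibreProduct.isOpenMap_snd (F.corr g).isOpenMap_mk hπc _ hO)
    convert hO'
    ext z
    constructor
    · rintro ⟨p, hp, rfl⟩
      let q : FibreProduct (Quotient.mk (F.corr g).orbitSetoid) π :=
        ⟨(p.1.1, ⟨((F.corr g).r p.1.1, m p), hm p⟩), hπ p⟩
      have hq : (⟨(q.1.1, ψ q), hψ q⟩ : FibreProduct (source g) r) = p :=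
        Subtype.ext (Prod.ext rfl (hψm p))
      exact ⟨_, ⟨q, (congrArg (· ∈ N) hq).mpr hp, rfl⟩, rfl⟩
    · rintro ⟨_, ⟨q, hq, rfl⟩, rfl⟩
      exact ⟨_, hq, hmψ q⟩
  · intro z hz
    obtain ⟨b, hb⟩ : ∃ b, r z = F.incl x' b := by
      generalize r z = c at hz
      obtain ⟨y, b⟩ := c
      subst hz
      exact ⟨b, rfl⟩
    obtain ⟨γ, hγ⟩ := Quotient.exists_rep (π ⟨(b, z), hb⟩)
    exact ⟨_, hmψ ⟨(γ, ⟨(b, z), hb⟩), hγ.symm⟩⟩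
  · intro p q hpq
    rw [← hπ p, ← hπ q, hfib p q hpq]
  · intro p q hpq h1
    refine Subtype.ext (Prod.ext h1 ?_)
    rw [← hψm p, ← hψm q]
    exact congrArg ψ (Subtype.ext (Prod.ext h1 (hfib p q hpq)))

/-- The extended action maps are compatible with the composition of correspondences. -/
theorem extension_act_act [T2Space Z] (hi : ExtendsBounded i)
    (h : ∀ y, r (i y) = A.anchor y)
    {m : ∀ {x x' : C} (g : x ⟶ x'), FibreProduct (source g) r → Z}
    (hmc : ∀ {x x' : C} (g : x ⟶ x'), Continuous (m g))
    (hm : ∀ {x x' : C} (g : x ⟶ x') p, r (m g p) = range g p.1.1)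
    (hmi : ∀ {x x' : C} (g : x ⟶ x') p,
      m g (FibreProduct.map i h p) = i (A.act g p.1.1 p.1.2 p.2))
    {x y z : C} (g : y ⟶ z) (k : x ⟶ y) (a b p)
    (e : (F.corr g).s a = (F.corr k).r b) (e' : r p = ⟨x, (F.corr k).s b⟩) :
    m g ⟨(a, m k ⟨(b, p), e'⟩), (hm k _).trans (by simp only [range, source, e])⟩ =
      m (k ≫ g) ⟨(F.mu g k (.mk _ _ a b e), p),
        e'.trans (by simp only [source, F.s_mu g k a b e])⟩ := by
  -- Density is tested on the fibre product before passing to the composite `Comp`, where both sides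
  -- are explicit continuous functions of the pair `(a, b)` and the point of `Z`.
  let σ : Correspondence.FibreProd (F.corr g) (F.corr k) → F.Base := fun c => source k c.1.2
  have hσ : IsOpenMap σ := by
    refine (isLocalHomeomorph_source k).isOpenMap.comp ?_
    let f : Correspondence.FibreProd (F.corr g) (F.corr k) ≃ₜ
        FibreProduct (F.corr g).s (F.corr k).r :=
      (Homeomorph.refl _).subtype fun _ => eq_comm
    exact (FibreProduct.isOpenMap_snd (F.corr g).isLocalHomeomorph_s.isOpenMap
      (F.corr k).continuous_r).comp f.isOpenMap
  have hd := FibreProduct.denseRange_map (s := σ) h hi.denseRange hσ r.continuous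
  have hk : Continuous fun c : FibreProduct σ r => m k ⟨(c.1.1.1.2, c.1.2), c.2⟩ :=
    (hmc k).comp (Continuous.subtype_mk (by fun_prop) _)
  refine eq_of_denseRange hd
    (f := fun c => m g ⟨(c.1.1.1.1, m k ⟨(c.1.1.1.2, c.1.2), c.2⟩), (hm k _).trans
      (by simp only [range, source, c.1.1.2])⟩)
    (g := fun c => m (k ≫ g) ⟨(F.mu g k (.mk _ _ c.1.1.1.1 c.1.1.1.2 c.1.1.2), c.1.2),
      c.2.trans (by simp only [σ, source, F.s_mu g k _ _ c.1.1.2])⟩) ?_ ?_ ?_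
    ⟨(⟨(a, b), e⟩, p), e'⟩
  · exact (hmc g).comp (Continuous.subtype_mk (Continuous.prodMk (by fun_prop) hk) _)
  · refine (hmc (k ≫ g)).comp (Continuous.subtype_mk (Continuous.prodMk ?_ (by fun_prop)) _)
    exact (F.mu g k).continuous.comp (continuous_quotient_mk'.comp (by fun_prop))
  · rintro ⟨⟨⟨⟨a, b⟩, e⟩, y⟩, f⟩
    have f' : A.anchor (A.act k b y f) = source g a :=
      (A.anchor_act k b y f).trans (by rw [source, e])
    have h1 : ∀ e', (⟨(a, m k (FibreProduct.map i h ⟨(b, y), f⟩)), e'⟩ :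
        FibreProduct (source g) r) = FibreProduct.map i h ⟨(a, A.act k b y f), f'⟩ :=
      fun _ => Subtype.ext (Prod.ext rfl (hmi k ⟨(b, y), f⟩))
    refine (congrArg (m g) (h1 _)).trans ((hmi g _).trans ?_)
    refine (congrArg i (A.act_act g k a b y e f)).trans ?_
    exact (hmi (k ≫ g) ⟨(F.mu g k (.mk _ _ a b e), y),
      f.trans (by simp only [σ, source, F.s_mu g k a b e])⟩).symm

/-- Two actions that extend the same action along a map with dense range agree. -/
theorem eq_of_isEquivariant [F.IsLocallyCompact] [T2Space Z] (hi : DenseRange i)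
    {A' A'' : F.Action Z} (h' : IsEquivariant A A' i) (h'' : IsEquivariant A A'' i) :
    A' = A'' := by
  have hanchor : A'.anchor = A''.anchor :=
    ContinuousMap.ext (eq_of_denseRange hi A'.anchor.continuous A''.anchor.continuous
      fun y => (h'.anchor y).trans (h''.anchor y).symm)
  have hact : ∀ {x x' : C} (g : x ⟶ x') (γ : (F.corr g).carrier) (z : Z)
      (e : A'.anchor z = ⟨x, (F.corr g).s γ⟩) (e' : A''.anchor z = ⟨x, (F.corr g).s γ⟩),
      A'.act g γ z e = A''.act g γ z e' := by
    intro x x' g γ z e e'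
    have hd := FibreProduct.denseRange_map (s := source g) h'.anchor hi
      (isLocalHomeomorph_source g).isOpenMap A'.anchor.continuous
    refine eq_of_denseRange hd (f := fun p => A'.act g p.1.1 p.1.2 p.2)
      (g := fun p => A''.act g p.1.1 p.1.2 (hanchor ▸ p.2)) (A'.continuous_act g)
      ((A''.continuous_act g).comp (Continuous.subtype_mk continuous_subtype_val fun p => hanchor ▸ p.2))
      (fun p => ?_) ⟨(γ, z), e⟩
    exact (h'.act g p.1.1 p.1.2 p.2).symm.trans (h''.act g p.1.1 p.1.2 p.2)
  obtain ⟨r', act', _⟩ := A'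
  obtain ⟨r'', act'', _⟩ := A''
  dsimp only at hanchor
  subst hanchor
  congr
  funext x x' g γ z e
  exact hact g γ z e e

/-- An `F`-action extends along a map `i` for which bounded continuous functions extend to a space
that is proper over `G⁰`. -/
theorem existsUnique_extension [F.IsLocallyCompact] (hF : F.IsProper) [T35Space Z]
    (hi : ExtendsBounded i) (hr : IsProperMap r) (h : ∀ y, r (i y) = A.anchor y) :
    ∃! A' : F.Action Z, IsEquivariant A A' i := by
  choose m hmc hmo hm hmi hms hmq hmj using
    fun {x x' : C} (g : x ⟶ x') => A.exists_extension_act_isOpenMap hF hi hr h g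
  -- The algebraic part comes first because condition (2) for `A'` uses `act_ract`: from `γ · z = (γ
  -- · η) · z' = γ · (η · z')`, injectivity for fixed `γ` gives `z = η · z'`.
  let P : F.PreAction Z :=
    { anchor := r
      act := fun g γ z e => m g ⟨(γ, z), e⟩
      anchor_act := fun g γ z e => hm g _
      act_act := fun g k a b p e e' => A.extension_act_act hi h hmc hm hmi g k a b p e e' }
  let A' : F.Action Z :=
    { anchor := r
      act := fun g γ z e => m g ⟨(γ, z), e⟩
      anchor_act := P.anchor_act
      continuous_act := fun g => hmc g
      isOpenMap_act := fun g => hmo g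
      surjective_act := fun g z hz => by
        obtain ⟨p, hp⟩ := hms g z hz
        exact ⟨p.1.1, p.1.2, p.2, hp⟩
      act_act := P.act_act
      exists_of_act_eq := by
        intro x x' g γ γ' z z' e e' hzz
        obtain ⟨k, f, hk⟩ := (F.corr g).mk_eq_mk_iff.1 (hmq g _ _ hzz)
        obtain ⟨η, rfl⟩ := (F.unitor x).surjective k
        dsimp only at f hk
        subst hk
        have f' : r z' = ⟨x, (F.corr (𝟙 x)).s η⟩ :=
          e'.trans (by rw [(F.corr g).s_ract, F.s_unitor])
        refine ⟨η, f, f', rfl, ?_⟩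
        have h1 := hmj g _ _ (hzz.trans (P.act_ract g γ η z' f f')) rfl
        exact congrArg (fun p => p.1.2) h1 }
  have hA' : IsEquivariant A A' i :=
    ⟨hi.continuous, h, fun g γ y e => (hmi g ⟨(γ, y), e⟩).symm⟩
  exact ⟨A', hA', fun A'' hA'' => A.eq_of_isEquivariant hi.denseRange hA'' hA'⟩

end Extension

end Action

end Diagram

theorem mainTheorem4 {C : Type v} [Category.{w} C] (F : Diagram.{u} C) [F.IsLocallyCompact]
    (hF : F.IsProper) {Y : Type t} [TopologicalSpace Y] (A : F.Action Y) :
    ∃! A' : F.Action (RelStoneCech A.anchor),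
      Diagram.IsEquivariant A A' (RelStoneCech.of A.anchor) := by
  obtain ⟨s, hs⟩ := RelStoneCech.exists_anchor A.anchor
  have hproper := RelStoneCech.isProperMap_anchor hs
  have := hproper.locallyCompactSpace
  have := t35Space_of_locallyCompact (RelStoneCech A.anchor)
  exact A.existsUnique_extension hF RelStoneCech.extendsBounded_of hproper hs
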